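/- **Setting.** The cake is $[0,1]$; a piece of cake is a finite union of intervals. There are 4 agents, each with a valuation $V_i$ of the pieces that is non-negative, additive ($V_i(X\cup Y)=V_i(X)+V_i(Y)$ for disjoint $X,Y$) and divisible (for every piece $X$ and $0\le\lambda\le1$ some piece $Y\subseteq X$ has $V_i(Y)=\lambda V_i(X)$). A discrete protocol is a deterministic procedure in the Robertson–Webb model: at each step it either asks an agent $i$ for $V_i([x,y])$ (Evaluate), or asks agent $i$ for a point $y\ge x$ with $V_i([x,y])=r$ (Cut; the agent says so if there is none), and it continues according to the replies; agents reply truthfully. It is bounded if the number of queries is bounded independently of the valuations. An allocation of disjoint pieces $A_1,\dots,A_4$ of a cake $R$ (some of $R$ may stay unallocated) is envy-free if $V_i(A_j)\le V_i(A_i)$ for all $i,j$. With unallocated residue $\beta=R\setminus\bigcup_l A_l$, agent $i$ dominates agent $j$ if $V_i(A_j\cup\beta)\le V_i(A_i)$. A *core protocol* with cutter $c$ on a cake $R$ is a bounded protocol that (i) cuts $R$ into four pieces $P_1,\dots,P_4$ of equal value to $c$; (ii) gives to each agent a right-hand part $Q_k\subseteq P_k$ of a different one of these pieces, so that no agent envies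 another; (iii) gives a complete piece ($Q_k=P_k$) to $c$ and to at least one other agent; and (iv) leaves all pieces complete if the three other agents can be given distinct most preferred pieces. The rest $\bigcup_k P_k\setminus Q_k$ stays unallocated. A piece $P_k$ is *significant* in the run if $V_c(P_k\setminus Q_k)$ is the largest of the four values $V_c(P_l\setminus Q_l)$. **Lemma (Permutation Lemma).** There is a discrete and bounded protocol for 4 agents that, given any specified agent $c$ (the cutter) and any unallocated cake $R$, returns a partial envy-free allocation of $R$ in which $c$ dominates two other agents. The number of queries is at most a number that depends only on the number of intervals that make up $R$; in particular it is at most a constant for $R=[0,1]$. Moreover, the protocol can be taken of the following form, for some core protocol: the core protocol with cutter $c$ is run five times, first on $R$ and then each time on the cake left unallocated by the run before, and each agent gets what she received in the five runs, except for the following. If there is an agent $j\ne c$ who, in each of the first four runs, is the only agent other than $c$ that gets a significant piece, then after the fourth run the four (possibly trimmed) pieces of exactly one of these four runs are reassigned among the four agents, so that $c$ still gets a complete piece and an agent other than $c$ and $j$ gets a significant piece of that run. -/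

import Mathlib

namespace CakeCutting

/-! ### Cake, pieces, valuations -/

/-- The cake `[0,1]`. -/
abbrev Cake : Type := unitInterval

/-- `X` is a union of at most `m` intervals (of any kind, possibly empty or degenerate) of the
cake `[0,1]`. -/
def IsPieceOf (m : ℕ) (X : Set Cake) : Prop :=
  ∃ F : Finset (Set Cake), F.card ≤ m ∧ (∀ J ∈ F, J.OrdConnected) ∧ ⋃₀ (F : Set (Set Cake)) = X

/-- A piece of cake: a finite union of intervals. -/
def IsPiece (X : Set Cake) : Prop := ∃ m, IsPieceOf m X

/-- A valuation: a nonnegative, additive and divisible function on pieces of cake.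
(The values of `val` at sets that are not pieces are irrelevant.) -/
structure Valuation where
  val : Set Cake → ℝ
  nonneg : ∀ X, IsPiece X → 0 ≤ val X
  additive : ∀ X Y, IsPiece X → IsPiece Y → Disjoint X Y → val (X ∪ Y) = val X + val Y
  divisible : ∀ X, IsPiece X → ∀ r : ℝ, 0 ≤ r → r ≤ 1 →
    ∃ Y, Y ⊆ X ∧ IsPiece Y ∧ val Y = r * val X

/-- There are four agents. -/
abbrev Agent := Fin 4

/-- Each agent has her own valuation. -/
abbrev Profile := Agent → Valuation

/-! ### Protocols in the Robertson-Webb query model -/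

/-- A deterministic protocol with output in `α`: a well-founded decision tree whose inner nodes
are queries and which continues according to the reply.
* `eval i x y k` asks agent `i` for her value of `[x, y]`;
* `cut i x r k` asks agent `i` for a point `y ≥ x` such that `[x, y]` has value `r` to her
  (the reply is `none` if there is no such point). -/
inductive Protocol (α : Type) : Type
  | ret (a : α) : Protocol α
  | eval (i : Agent) (x y : Cake) (k : ℝ → Protocol α) : Protocol α
  | cut (i : Agent) (x : Cake) (r : ℝ) (k : Option Cake → Protocol α) : Protocol α

/-- Run one protocol, then continue with another one that depends on its output. -/
def Protocol.bind {α β : Type} : Protocol α → (α → Protocol β) → Protocol β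
  | .ret a, f => f a
  | .eval i x y k, f => .eval i x y fun v => (k v).bind f
  | .cut i x r k, f => .cut i x r fun z => (k z).bind f

/-- `z` is a truthful reply of an agent with valuation `v` to the cut query `(x, r)`. -/
def IsCutReply (v : Valuation) (x : Cake) (r : ℝ) : Option Cake → Prop
  | some y => x ≤ y ∧ v.val (Set.Icc x y) = r
  | none => ¬ ∃ y, x ≤ y ∧ v.val (Set.Icc x y) = r

/-- `Run V p n a`: with agents of valuations `V` who reply truthfully, the protocol `p` can end
with output `a` after exactly `n` queries. -/
inductive Protocol.Run {α : Type} (V : Profile) : Protocol α → ℕ → α → Prop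
  | ret (a : α) : Run V (.ret a) 0 a
  | eval {i : Agent} {x y : Cake} {k : ℝ → Protocol α} {n : ℕ} {a : α}
      (h : Run V (k ((V i).val (Set.Icc x y))) n a) : Run V (.eval i x y k) (n + 1) a
  | cut {i : Agent} {x : Cake} {r : ℝ} {k : Option Cake → Protocol α} {z : Option Cake} {n : ℕ} {a : α}
      (hz : IsCutReply (V i) x r z) (h : Run V (k z) n a) : Run V (.cut i x r k) (n + 1) a

/-! ### Partial envy-free allocations and domination -/

/-- `A` is an allocation of (possibly only a part of) the cake `R`: disjoint pieces of `R`. -/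
def IsPartialAllocation (R : Set Cake) (A : Agent → Set Cake) : Prop :=
  (∀ i, IsPiece (A i) ∧ A i ⊆ R) ∧ ∀ i j, i ≠ j → Disjoint (A i) (A j)

/-- No agent prefers the share of another agent to her own. -/
def IsEnvyFree (V : Profile) (A : Agent → Set Cake) : Prop :=
  ∀ i j, (V i).val (A j) ≤ (V i).val (A i)

/-- Agent `i` dominates agent `j` in the partial allocation `A` of `R`: `i` would not envy `j`
even if `j` also received all of the unallocated cake. -/
def Dominates (V : Profile) (R : Set Cake) (A : Agent → Set Cake) (i j : Agent) : Prop :=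
  (V i).val (A j ∪ (R \ ⋃ l, A l)) ≤ (V i).val (A i)

/-! ### The core protocol -/

/-- The outcome of one run of a core protocol: the four pieces into which the cake is cut,
the part of each piece that is handed out (the rest has been trimmed off), and an assignment of
the four parts to the four agents: agent `i` receives `part (assign i)`. -/
structure CoreOutcome where
  piece : Fin 4 → Set Cake
  part : Fin 4 → Set Cake
  assign : Agent ≃ Fin 4

/-- The cake left unallocated by the run. -/
def CoreOutcome.residue (o : CoreOutcome) : Set Cake := ⋃ k, o.piece k \ o.part k

/-- Piece `k` is handed out completely. -/
def CoreOutcome.Complete (o : CoreOutcome) (k : Fin 4) : Prop := o.part k = o.piece k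

/-- Piece `k` is significant: to the cutter, whose valuation is `v`, no piece has had a more
valuable residue trimmed off. -/
def CoreOutcome.Significant (o : CoreOutcome) (v : Valuation) (k : Fin 4) : Prop :=
  ∀ l, v.val (o.piece l \ o.part l) ≤ v.val (o.piece k \ o.part k)

/-- What a core protocol with cutter `c` has to achieve on the cake `R`. -/
structure IsCoreOutcome (V : Profile) (c : Agent) (R : Set Cake) (o : CoreOutcome) : Prop where
  /-- The cake is cut into four pieces that are equally preferred by the cutter. -/
  isPiece : ∀ k, IsPiece (o.piece k)
  disjoint : ∀ k l, k ≠ l → Disjoint (o.piece k) (o.piece l)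
  iUnion_piece : ⋃ k, o.piece k = R
  equal : ∀ k l, (V c).val (o.piece k) = (V c).val (o.piece l)
  /-- Each piece is trimmed from the left, so a right-hand part of it is handed out. -/
  isPiece_part : ∀ k, IsPiece (o.part k)
  part_subset : ∀ k, o.part k ⊆ o.piece k
  right_part : ∀ k, ∀ x ∈ o.part k, ∀ y ∈ o.piece k, x ≤ y → y ∈ o.part k
  /-- The cutter and at least one other agent get complete pieces. -/
  complete_cutter : o.Complete (o.assign c)
  complete_other : ∃ i, i ≠ c ∧ o.Complete (o.assign i)
  /-- The parts are allocated without envy. -/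
  envyFree : IsEnvyFree V fun i => o.part (o.assign i)
  /-- If the other agents can be given distinct most preferred pieces, nothing is trimmed. -/
  most_preferred : (∃ τ : Agent ≃ Fin 4, ∀ i, i ≠ c →
    ∀ k, (V i).val (o.piece k) ≤ (V i).val (o.piece (τ i))) → ∀ k, o.Complete k

/-! ### Five runs of the core protocol with a reallocation -/

/-- The result of the protocol below: the outcomes of the five runs, and for each run the final
assignment of the parts: agent `i` ends up with `(run t).part (holder t i)` from run `t`. -/
structure Outcome where
  run : Fin 5 → CoreOutcome
  holder : Fin 5 → Agent ≃ Fin 4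

/-- The resulting share of agent `i`. -/
def Outcome.share (o : Outcome) (i : Agent) : Set Cake := ⋃ t, (o.run t).part (o.holder t i)

/-- Run the core protocol `core` with cutter `c` four times, first on the cake `R` and then always
on the cake left over; let `realloc` reassign the parts within these four runs; run the core
protocol once more on the cake left over. -/
def permutationProtocol (core : Agent → Set Cake → Protocol CoreOutcome)
    (realloc : Agent → (Fin 4 → CoreOutcome) → Protocol (Fin 4 → Agent ≃ Fin 4))
    (c : Agent) (R : Set Cake) : Protocol Outcome :=
  (core c R).bind fun o₀ =>
  (core c o₀.residue).bind fun o₁ =>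
  (core c o₁.residue).bind fun o₂ =>
  (core c o₂.residue).bind fun o₃ =>
  (realloc c ![o₀, o₁, o₂, o₃]).bind fun σ =>
  (core c o₃.residue).bind fun o₄ =>
  .ret { run := ![o₀, o₁, o₂, o₃, o₄], holder := ![σ 0, σ 1, σ 2, σ 3, o₄.assign] }

/-- Agent `j` is, among the agents other than the cutter `c`, the one and only agent that gets a
significant piece in each of the first four runs. -/
def Outcome.SameAgent (o : Outcome) (V : Profile) (c j : Agent) : Prop :=
  j ≠ c ∧ ∀ t, t ≠ Fin.last 4 → ∀ i, i ≠ c →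
    ((o.run t).Significant (V c) ((o.run t).assign i) ↔ i = j)

/-- One of the first four runs, and no other run, has been reallocated, in such a way that the
cutter `c` still has a complete piece and an agent other than `c` and `j` has a significant piece
of that run. -/
def Outcome.Reallocated (o : Outcome) (V : Profile) (c j : Agent) : Prop :=
  ∃ t, t ≠ Fin.last 4 ∧ (∀ s, s ≠ t → o.holder s = (o.run s).assign) ∧
    (o.run t).Complete (o.holder t c) ∧
    ∃ i, i ≠ c ∧ i ≠ j ∧ (o.run t).Significant (V c) (o.holder t i)

end CakeCutting

open CakeCutting

/-!
The cake is handled through two subroutines: a piece that consists of `m` intervals can be evaluated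
with `m` queries, and a left-hand part of prescribed value can be cut off it with about `2 * m ^ 2`
queries. That such cuts exist is where divisibility is used: it excludes concentrated value, so that
the value of `[0, y]` is a continuous function of `y` (`Valuation.continuous_val_Iic`).

**The core protocol.** After the cutter has cut the cake into quarters, the other three agents compete
for the pieces. If they cannot be given distinct favourites, two of them share a favourite `p`. Let
all three trim `p` to the value of their best other pieces, and apply the second-deepest trim. The agent
with the deepest trim takes `p`; if the other two have different best alternatives, all is well.
Otherwise both have the same alternative `q`. Then the agents compete for `p` and `q` with the two
remaining pieces as alternatives. If different agents have the deepest trims on `p` and on `q`, then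
the second-deepest trim is applied to each of the two pieces, and the third agent gets a remaining
piece. If the same agent is first on both, then she gets the one that she prefers, and the other one is
trimmed just so far that she does not want it more and that only one of her competitors still wants
it (`exists_goodTrim_of_contest`). All trims that occur here belong to a finite set, obtained from the
untrimmed pieces by two rounds of "trim piece `k` to the value of the possibly trimmed piece `l`"
(`exists_goodTrim_of_grid`). The protocol therefore collects all of these trims, evaluates everything,
and selects a solution.

**Domination.** The cutter and another agent have complete pieces, so the residue of a run comes from
at most two pieces, and is worth to the cutter at most half of the cake of that run. Hence what has been
trimmed off a significant piece in one of the first four runs is worth at least as much to her as the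
residue of the fifth run, and she dominates every agent who holds a significant piece in one of these
runs (`IsRunSequence.dominates`). The only obstacle is that the same agent `j` gets it all four times.

**Reallocation.** In the solutions selected by the core protocol, the holder of a trimmed piece can be
made to give it away in such a way that every agent except for the cutter keeps her part or gets her
second choice, while the cutter still has a complete piece: following second choices leads
around a cycle, in which the cutter can take part since she likes all complete pieces equally
(`exists_swap`). An agent with a second choice envies only the new holder of her former part, by her
margin between first and second choice. This margin is made good in another run where her
margin is at least as large. Each of the three agents has her strictly largest margin in at most one run,
so one of the four runs can be reallocated (`exists_reassignment`).
-/

namespace CakeCutting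

/-! ### Pieces of cake -/

section PiecesAndValuations

open Set Filter Topology

theorem IsPieceOf.isPiece {m : ℕ} {X : Set Cake} (h : IsPieceOf m X) : IsPiece X := ⟨m, h⟩

theorem IsPieceOf.mono {m n : ℕ} {X : Set Cake} (h : IsPieceOf m X) (hmn : m ≤ n) :
    IsPieceOf n X := by
  obtain ⟨F, hF, hJ, rfl⟩ := h
  exact ⟨F, hF.trans hmn, hJ, rfl⟩

theorem isPieceOf_empty : IsPieceOf 0 ∅ := ⟨∅, by simp, by simp, by simp⟩

theorem isPiece_empty : IsPiece ∅ := isPieceOf_empty.isPiece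

theorem isPiece_of_ordConnected {J : Set Cake} (hJ : J.OrdConnected) : IsPiece J :=
  ⟨1, {J}, by simp, by simpa using hJ, by simp⟩

open Classical in
theorem IsPieceOf.union {m n : ℕ} {X Y : Set Cake} (hX : IsPieceOf m X) (hY : IsPieceOf n Y) :
    IsPieceOf (m + n) (X ∪ Y) := by
  obtain ⟨F, hF, hJ, rfl⟩ := hX
  obtain ⟨G, hG, hK, rfl⟩ := hY
  refine ⟨F ∪ G, (Finset.card_union_le _ _).trans (by omega), ?_, ?_⟩
  · intro J hJ'
    rcases Finset.mem_union.1 hJ' with h | h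
    exacts [hJ _ h, hK _ h]
  · rw [Finset.coe_union, sUnion_union]

open Classical in
theorem IsPieceOf.inter_ordConnected {m : ℕ} {X I : Set Cake} (hX : IsPieceOf m X)
    (hI : I.OrdConnected) : IsPieceOf m (X ∩ I) := by
  obtain ⟨F, hF, hJ, rfl⟩ := hX
  refine ⟨F.image (· ∩ I), Finset.card_image_le.trans hF, ?_, ?_⟩
  · intro J hJ'
    obtain ⟨J', h, rfl⟩ := Finset.mem_image.1 hJ'
    exact (hJ _ h).inter hI
  · ext x
    simp only [Finset.coe_image, sUnion_image, mem_iUnion, mem_inter_iff, mem_sUnion]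
    simp only [Finset.mem_coe, exists_prop]
    tauto

theorem IsPieceOf.iUnion_fin {m n : ℕ} {X : Fin n → Set Cake} (hX : ∀ k, IsPieceOf m (X k)) :
    IsPieceOf (n * m) (⋃ k, X k) := by
  induction n with
  | zero => simpa using isPieceOf_empty
  | succ n ih =>
    have : ⋃ k, X k = X 0 ∪ ⋃ k : Fin n, X k.succ := by
      ext x; simp [Fin.exists_fin_succ]
    rw [this]
    exact ((hX 0).union (ih fun k => hX k.succ)).mono (by rw [Nat.succ_mul, add_comm])

theorem IsPiece.union {X Y : Set Cake} (hX : IsPiece X) (hY : IsPiece Y) : IsPiece (X ∪ Y) := by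
  obtain ⟨m, hm⟩ := hX
  obtain ⟨n, hn⟩ := hY
  exact ⟨_, hm.union hn⟩

theorem IsPiece.inter_ordConnected {X I : Set Cake} (hX : IsPiece X) (hI : I.OrdConnected) :
    IsPiece (X ∩ I) := by
  obtain ⟨m, hm⟩ := hX
  exact ⟨m, hm.inter_ordConnected hI⟩

theorem IsPiece.iUnion_fin {n : ℕ} {X : Fin n → Set Cake} (hX : ∀ k, IsPiece (X k)) :
    IsPiece (⋃ k, X k) := by
  choose m hm using hX
  exact ⟨_, IsPieceOf.iUnion_fin fun k =>
    (hm k).mono (Finset.single_le_sum (f := m) (fun _ _ => Nat.zero_le _) (Finset.mem_univ k))⟩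

theorem IsPiece.diff_ordConnected {X J : Set Cake} (hX : IsPiece X) (hJ : J.OrdConnected) :
    IsPiece (X \ J) := by
  have hlo : {x : Cake | ∀ j ∈ J, x < j}.OrdConnected :=
    ⟨fun _ _ _ hy _ hz j hj => hz.2.trans_lt (hy j hj)⟩
  have hup : {x : Cake | ∀ j ∈ J, j < x}.OrdConnected :=
    ⟨fun _ hx _ _ _ hz j hj => (hx j hj).trans_le hz.1⟩
  have : X \ J = (X ∩ {x : Cake | ∀ j ∈ J, x < j}) ∪ (X ∩ {x : Cake | ∀ j ∈ J, j < x}) := by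
    ext x
    constructor
    · rintro ⟨hx, hxJ⟩
      by_cases h : ∀ j ∈ J, x < j
      · exact .inl ⟨hx, h⟩
      · push Not at h
        obtain ⟨i, hi, hix⟩ := h
        refine .inr ⟨hx, fun j hj => lt_of_not_ge fun hxj => hxJ (hJ.out hi hj ⟨hix, hxj⟩)⟩
    · rintro (⟨hx, h⟩ | ⟨hx, h⟩)
      exacts [⟨hx, fun h' => (h x h').false⟩, ⟨hx, fun h' => (h x h').false⟩]
  rw [this]
  exact (hX.inter_ordConnected hlo).union (hX.inter_ordConnected hup)

open Classical in
theorem IsPiece.diff {X Y : Set Cake} (hX : IsPiece X) (hY : IsPiece Y) : IsPiece (X \ Y) := by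
  obtain ⟨m, F, -, hJ, rfl⟩ := hY
  induction F using Finset.induction_on with
  | empty => simpa using hX
  | insert J F _ ih =>
    have : X \ ⋃₀ ((insert J F : Finset (Set Cake)) : Set (Set Cake)) =
        (X \ ⋃₀ (F : Set (Set Cake))) \ J := by
      rw [Finset.coe_insert, sUnion_insert, union_comm, sdiff_sdiff]
    rw [this]
    exact (ih fun K hK => hJ K (Finset.mem_insert_of_mem hK)).diff_ordConnected
      (hJ J (Finset.mem_insert_self _ _))

/-- A piece of cake is, up to merging overlapping intervals, a disjoint union of intervals: a
family of intervals of the least possible size has this property. -/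
theorem IsPiece.exists_disjoint_family {X : Set Cake} (hX : IsPiece X) :
    ∃ F : Finset (Set Cake), (∀ J ∈ F, J.OrdConnected) ∧ ⋃₀ (F : Set (Set Cake)) = X ∧
      (∀ I ∈ F, ∀ J ∈ F, I ≠ J → Disjoint I J) ∧ ∀ m, IsPieceOf m X → F.card ≤ m := by
  classical
  obtain ⟨F, hF, hJ, hU⟩ := Nat.find_spec hX
  refine ⟨F, hJ, hU, ?_, fun m hm => hF.trans (Nat.find_min' hX hm)⟩
  intro I hI J hJ' hne
  by_contra hdis
  obtain ⟨x, hxI, hxJ⟩ := not_disjoint_iff.1 hdis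
  have hIF : J ∈ F.erase I := Finset.mem_erase.2 ⟨hne.symm, hJ'⟩
  have h1 := Finset.card_erase_add_one hI
  have h2 := Finset.card_erase_add_one hIF
  have hmerge : IsPieceOf (Nat.find hX - 1) X := by
    refine ⟨insert (I ∪ J) ((F.erase I).erase J), ?_, ?_, ?_⟩
    · refine (Finset.card_insert_le _ _).trans ?_
      omega
    · intro K hK
      rcases Finset.mem_insert.1 hK with rfl | hK
      · refine ⟨fun a ha b hb z hz => ?_⟩
        have hIc := hJ I hI
        have hJc := hJ J hJ'
        rcases le_total z x with h | h
        · rcases ha with ha | ha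
          exacts [.inl (hIc.out ha hxI ⟨hz.1, h⟩), .inr (hJc.out ha hxJ ⟨hz.1, h⟩)]
        · rcases hb with hb | hb
          exacts [.inl (hIc.out hxI hb ⟨h, hz.2⟩), .inr (hJc.out hxJ hb ⟨h, hz.2⟩)]
      · exact hJ K (Finset.mem_of_mem_erase (Finset.mem_of_mem_erase hK))
    · rw [← hU]
      ext y
      simp only [mem_sUnion, Finset.mem_coe, Finset.mem_insert, Finset.mem_erase]
      constructor
      · rintro ⟨K, rfl | ⟨-, -, hK⟩, hy⟩
        · rcases hy with hy | hy
          exacts [⟨I, hI, hy⟩, ⟨J, hJ', hy⟩]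
        · exact ⟨K, hK, hy⟩
      · rintro ⟨K, hK, hy⟩
        by_cases h1 : K = I
        · exact ⟨_, .inl rfl, .inl (h1 ▸ hy)⟩
        by_cases h2 : K = J
        · exact ⟨_, .inl rfl, .inr (h2 ▸ hy)⟩
        exact ⟨K, .inr ⟨h2, h1, hK⟩, hy⟩
  have := Nat.find_min' hX hmerge
  omega

/-! ### Valuations -/

namespace Valuation

variable (v : Valuation)

theorem val_empty : v.val ∅ = 0 := by
  have := v.additive ∅ ∅ isPiece_empty isPiece_empty (disjoint_empty _)
  rw [union_self] at this
  linarith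

theorem val_diff_add {X Y : Set Cake} (hX : IsPiece X) (hY : IsPiece Y) (h : Y ⊆ X) :
    v.val (X \ Y) + v.val Y = v.val X := by
  rw [← v.additive _ _ (hX.diff hY) hY disjoint_sdiff_left, sdiff_union_of_subset h]

theorem val_mono {X Y : Set Cake} (hX : IsPiece X) (hY : IsPiece Y) (h : Y ⊆ X) :
    v.val Y ≤ v.val X := by
  linarith [v.val_diff_add hX hY h, v.nonneg _ (hX.diff hY)]

theorem val_iUnion_fin {n : ℕ} {X : Fin n → Set Cake} (hX : ∀ k, IsPiece (X k))
    (hd : ∀ k l, k ≠ l → Disjoint (X k) (X l)) : v.val (⋃ k, X k) = ∑ k, v.val (X k) := by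
  induction n with
  | zero => simp [v.val_empty]
  | succ n ih =>
    have : ⋃ k, X k = X 0 ∪ ⋃ k : Fin n, X k.succ := by
      ext x; simp [Fin.exists_fin_succ]
    rw [this, v.additive _ _ (hX 0) (IsPiece.iUnion_fin fun k => hX k.succ), Fin.sum_univ_succ,
      ih (fun k => hX k.succ) fun k l h => hd _ _ (by simpa using h)]
    exact disjoint_iUnion_right.2 fun k => hd _ _ (Fin.succ_ne_zero k).symm

/-- Divisibility excludes concentrated value: if every interval belongs to the filter `l` or else
has its complement there, then `l` contains intervals of arbitrarily small value. Otherwise an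
interval of `l` of nearly minimal value could not be divided into halves, as one of the two halves
would have to carry all of the concentrated value. -/
theorem exists_small (l : Filter Cake) (hl : ∀ J : Set Cake, J.OrdConnected → J ∈ l ∨ Jᶜ ∈ l)
    (hb : ∀ s ∈ l, ∃ J ∈ l, J.OrdConnected ∧ J ⊆ s) {ε : ℝ} (hε : 0 < ε) :
    ∃ J ∈ l, J.OrdConnected ∧ v.val J < ε := by
  by_contra! hcon
  have hpiece : ∀ Y, IsPiece Y → Y ∈ l ∨ Yᶜ ∈ l := by
    rintro Y ⟨m, F, -, hF, rfl⟩
    by_cases h : ∃ J ∈ F, J ∈ l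
    · obtain ⟨J, hJF, hJ⟩ := h
      exact .inl (mem_of_superset hJ (subset_sUnion_of_mem hJF))
    · push Not at h
      right
      have : ⋂ J ∈ F, Jᶜ ∈ l :=
        (biInter_finset_mem F).2 fun J hJ => (hl J (hF J hJ)).resolve_left (h J hJ)
      refine mem_of_superset this fun x hx => ?_
      simp only [mem_iInter, mem_compl_iff] at hx
      rintro ⟨J, hJ, hxJ⟩
      exact hx J hJ hxJ
  let S : Set ℝ := v.val '' {J | J ∈ l ∧ J.OrdConnected}
  have hbdd : BddBelow S := ⟨ε, by rintro _ ⟨J, ⟨h1, h2⟩, rfl⟩; exact hcon J h1 h2⟩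
  have hne : S.Nonempty := by
    obtain ⟨J, h1, h2, -⟩ := hb _ univ_mem
    exact ⟨_, J, ⟨h1, h2⟩, rfl⟩
  have hinf : ε ≤ sInf S :=
    le_csInf hne (by rintro _ ⟨J, ⟨h1, h2⟩, rfl⟩; exact hcon J h1 h2)
  obtain ⟨_, ⟨J, ⟨hJl, hJc⟩, rfl⟩, hJ⟩ := exists_lt_of_csInf_lt hne
    (show sInf S < 2 * sInf S by linarith)
  have hJp := isPiece_of_ordConnected hJc
  obtain ⟨Y, hYJ, hY, hval⟩ := v.divisible J hJp (1 / 2) (by norm_num) (by norm_num)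
  rcases hpiece Y hY with h | h
  · obtain ⟨I, hIl, hIc, hIY⟩ := hb _ h
    have h1 := v.val_mono hY (isPiece_of_ordConnected hIc) hIY
    have h2 : sInf S ≤ v.val I := csInf_le hbdd ⟨I, ⟨hIl, hIc⟩, rfl⟩
    linarith
  · obtain ⟨I, hIl, hIc, hIY⟩ := hb _ (inter_mem hJl h)
    have h1 := v.val_mono (hJp.diff hY) (isPiece_of_ordConnected hIc) (by exact hIY)
    have h2 : sInf S ≤ v.val I := csInf_le hbdd ⟨I, ⟨hIl, hIc⟩, rfl⟩
    have h3 := v.val_diff_add hJp hY hYJ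
    linarith

theorem val_singleton (x : Cake) : v.val {x} = 0 := by
  refine le_antisymm (le_of_forall_pos_lt_add fun ε hε => ?_)
    (v.nonneg _ (isPiece_of_ordConnected ordConnected_singleton))
  obtain ⟨J, hJ, hJc, h⟩ := v.exists_small (pure x) (fun J _ => by
    by_cases h : x ∈ J <;> simp [h]) (fun s hs => ⟨{x}, by simp, ordConnected_singleton, by
    simpa using hs⟩) hε
  have := v.val_mono (isPiece_of_ordConnected hJc)
    (isPiece_of_ordConnected ordConnected_singleton) (singleton_subset_iff.2 (mem_pure.1 hJ))
  linarith

theorem val_subsingleton {X : Set Cake} (hX : X.Subsingleton) : v.val X = 0 := by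
  rcases hX.eq_empty_or_singleton with rfl | ⟨x, rfl⟩
  exacts [v.val_empty, v.val_singleton x]

/-- Changing an interval at its end points does not change its value. -/
theorem val_eq_of_subset_insert {X Y : Set Cake} {a b : Cake} (hX : IsPiece X) (hY : IsPiece Y)
    (h : X ⊆ Y) (hab : ∀ y ∈ Y, y ∉ X → y = a ∨ y = b) : v.val X = v.val Y := by
  have h1 := v.val_diff_add hY hX h
  have h2 : IsPiece ({a} ∪ {b} : Set Cake) :=
    (isPiece_of_ordConnected ordConnected_singleton).union
      (isPiece_of_ordConnected ordConnected_singleton)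
  have h3 : IsPiece ({b} \ {a} : Set Cake) :=
    (isPiece_of_ordConnected ordConnected_singleton).diff
      (isPiece_of_ordConnected ordConnected_singleton)
  have h4 : v.val ({a} ∪ {b}) = 0 := by
    rw [← union_sdiff_self, v.additive _ _ (isPiece_of_ordConnected ordConnected_singleton) h3
      disjoint_sdiff_right, v.val_singleton,
      v.val_subsingleton (subsingleton_singleton.anti sdiff_subset), add_zero]
  have h5 := v.val_mono h2 (hY.diff hX) fun y hy => hab y hy.1 hy.2
  linarith [v.nonneg _ (hY.diff hX)]

theorem exists_small_Ioo_right {x : Cake} (hx : x < 1) {ε : ℝ} (hε : 0 < ε) :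
    ∃ u, x < u ∧ v.val (Ioo x u) < ε := by
  have hb : ∀ s ∈ 𝓝[>] x, ∃ u, x < u ∧ Ioo x u ⊆ s := fun s hs =>
    (mem_nhdsGT_iff_exists_Ioo_subset' hx).1 hs
  obtain ⟨J, hJ, hJc, hlt⟩ := v.exists_small (𝓝[>] x) (fun J hJ => by
      by_cases h : ∃ᶠ z in 𝓝[>] x, z ∈ J
      · left
        obtain ⟨z, hzJ, hz⟩ := (h.and_eventually self_mem_nhdsWithin).exists
        refine mem_of_superset (Ioo_mem_nhdsGT hz) fun w hw => ?_
        obtain ⟨y, hyJ, hy⟩ := (h.and_eventually (Ioo_mem_nhdsGT hw.1)).exists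
        exact hJ.out hyJ hzJ ⟨hy.2.le, hw.2.le⟩
      · exact .inr (not_frequently.1 h))
    (fun s hs => by
      obtain ⟨u, hu, h⟩ := hb s hs
      exact ⟨_, Ioo_mem_nhdsGT hu, ordConnected_Ioo, h⟩) hε
  obtain ⟨u, hu, h⟩ := hb J hJ
  exact ⟨u, hu, (v.val_mono (isPiece_of_ordConnected hJc)
    (isPiece_of_ordConnected ordConnected_Ioo) h).trans_lt hlt⟩

theorem exists_small_Ioo_left {x : Cake} (hx : 0 < x) {ε : ℝ} (hε : 0 < ε) :
    ∃ u, u < x ∧ v.val (Ioo u x) < ε := by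
  have hb : ∀ s ∈ 𝓝[<] x, ∃ u, u < x ∧ Ioo u x ⊆ s := fun s hs =>
    (mem_nhdsLT_iff_exists_Ioo_subset' hx).1 hs
  obtain ⟨J, hJ, hJc, hlt⟩ := v.exists_small (𝓝[<] x) (fun J hJ => by
      by_cases h : ∃ᶠ z in 𝓝[<] x, z ∈ J
      · left
        obtain ⟨z, hzJ, hz⟩ := (h.and_eventually self_mem_nhdsWithin).exists
        refine mem_of_superset (Ioo_mem_nhdsLT hz) fun w hw => ?_
        obtain ⟨y, hyJ, hy⟩ := (h.and_eventually (Ioo_mem_nhdsLT hw.2)).exists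
        exact hJ.out hzJ hyJ ⟨hw.1.le, hy.1.le⟩
      · exact .inr (not_frequently.1 h))
    (fun s hs => by
      obtain ⟨u, hu, h⟩ := hb s hs
      exact ⟨_, Ioo_mem_nhdsLT hu, ordConnected_Ioo, h⟩) hε
  obtain ⟨u, hu, h⟩ := hb J hJ
  exact ⟨u, hu, (v.val_mono (isPiece_of_ordConnected hJc)
    (isPiece_of_ordConnected ordConnected_Ioo) h).trans_lt hlt⟩

theorem val_Iic_eq_add {x y : Cake} (h : x ≤ y) :
    v.val (Iic y) = v.val (Iic x) + v.val (Icc x y) := by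
  have h1 : v.val (Ioc x y) = v.val (Icc x y) :=
    v.val_eq_of_subset_insert (a := x) (b := x) (isPiece_of_ordConnected ordConnected_Ioc)
      (isPiece_of_ordConnected ordConnected_Icc) Ioc_subset_Icc_self (by
        intro z hz hz'
        simp only [mem_Ioc, mem_Icc, not_and] at hz hz'
        exact .inl (le_antisymm (not_lt.1 fun h => hz' h hz.2) hz.1))
  rw [← h1, ← Iic_union_Ioc_eq_Iic h]
  refine v.additive _ _ (isPiece_of_ordConnected ordConnected_Iic)
    (isPiece_of_ordConnected ordConnected_Ioc) ?_
  exact disjoint_left.2 fun z hz hz' => hz.not_gt hz'.1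

theorem val_Ioo {x y : Cake} : v.val (Ioo x y) = v.val (Icc x y) :=
  v.val_eq_of_subset_insert (a := x) (b := y) (isPiece_of_ordConnected ordConnected_Ioo)
    (isPiece_of_ordConnected ordConnected_Icc) Ioo_subset_Icc_self (by
      intro z hz hz'
      simp only [mem_Ioo, mem_Icc, not_and] at hz hz'
      rcases hz.1.eq_or_lt with h | h
      exacts [.inl h.symm, .inr (le_antisymm hz.2 (not_lt.1 (hz' h)))])

theorem monotone_val_Iic : Monotone fun y => v.val (Iic y) := fun _ _ h =>
  v.val_mono (isPiece_of_ordConnected ordConnected_Iic) (isPiece_of_ordConnected ordConnected_Iic)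
    (Iic_subset_Iic.2 h)

theorem continuous_val_Iic : Continuous fun y => v.val (Iic y) := by
  have hmono := v.monotone_val_Iic
  rw [continuous_iff_continuousAt]
  intro x
  rw [ContinuousAt, tendsto_order]
  constructor
  · intro a ha
    rcases (bot_le : (0 : Cake) ≤ x).eq_or_lt with h0 | h0
    · exact .of_forall fun y => ha.trans_le (hmono (h0 ▸ bot_le : x ≤ y))
    obtain ⟨u, hu, h⟩ := v.exists_small_Ioo_left h0 (sub_pos.2 ha)
    filter_upwards [lt_mem_nhds hu] with y hy
    have h1 := v.val_Iic_eq_add hu.le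
    rw [← v.val_Ioo] at h1
    have h2 : v.val (Iic u) ≤ v.val (Iic y) := hmono hy.le
    linarith
  · intro a ha
    rcases (le_top : x ≤ (1 : Cake)).eq_or_lt with h0 | h0
    · exact .of_forall fun y => (hmono (h0 ▸ le_top : y ≤ x)).trans_lt ha
    obtain ⟨u, hu, h⟩ := v.exists_small_Ioo_right h0 (sub_pos.2 ha)
    filter_upwards [gt_mem_nhds hu] with y hy
    have h1 := v.val_Iic_eq_add hu.le
    rw [← v.val_Ioo] at h1
    have h2 : v.val (Iic y) ≤ v.val (Iic u) := hmono hy.le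
    linarith

/-- A positive amount of at most the value of `[x, z]` is the value of some `[x, y]`. -/
theorem exists_val_Icc_eq {x z : Cake} {r : ℝ} (hxz : x ≤ z) (hr : 0 < r)
    (hrz : r ≤ v.val (Icc x z)) : ∃ y, x ≤ y ∧ v.val (Icc x y) = r := by
  have h1 := v.val_Iic_eq_add hxz
  obtain ⟨y, hy⟩ := mem_range_of_exists_le_of_exists_ge v.continuous_val_Iic
    (c := v.val (Iic x) + r) ⟨x, by linarith⟩ ⟨z, by linarith⟩
  simp only at hy
  have hxy : x ≤ y := by
    by_contra! h
    have : v.val (Iic y) ≤ v.val (Iic x) := v.monotone_val_Iic h.le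
    linarith
  exact ⟨y, hxy, by linarith [v.val_Iic_eq_add hxy]⟩

theorem val_sUnion (F : Finset (Set Cake)) (hF : ∀ J ∈ F, J.OrdConnected)
    (hd : ∀ I ∈ F, ∀ J ∈ F, I ≠ J → Disjoint I J) :
    v.val (⋃₀ (F : Set (Set Cake))) = ∑ J ∈ F, v.val J := by
  classical
  induction F using Finset.induction_on with
  | empty => simp [v.val_empty]
  | insert J F hJF ih =>
    rw [Finset.sum_insert hJF, Finset.coe_insert, sUnion_insert, v.additive, ih]
    · exact fun K hK => hF K (Finset.mem_insert_of_mem hK)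
    · exact fun I hI K hK => hd I (Finset.mem_insert_of_mem hI) K (Finset.mem_insert_of_mem hK)
    · exact isPiece_of_ordConnected (hF J (Finset.mem_insert_self _ _))
    · exact ⟨_, F, le_rfl, fun K hK => hF K (Finset.mem_insert_of_mem hK), rfl⟩
    · refine disjoint_sUnion_right.2 fun K hK => hd J (Finset.mem_insert_self _ _) K
        (Finset.mem_insert_of_mem hK) ?_
      rintro rfl
      exact hJF hK

theorem val_ordConnected {J : Set Cake} (hJ : J.OrdConnected) :
    v.val J = v.val (Icc (sInf J) (sSup J)) := by
  refine v.val_eq_of_subset_insert (a := sInf J) (b := sSup J) (isPiece_of_ordConnected hJ)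
    (isPiece_of_ordConnected ordConnected_Icc) (fun x hx => ⟨sInf_le hx, le_sSup hx⟩) ?_
  intro y hy hyJ
  by_contra! h
  obtain ⟨a, ha, hay⟩ := sInf_lt_iff.1 (lt_of_le_of_ne hy.1 h.1.symm)
  obtain ⟨b, hb, hyb⟩ := lt_sSup_iff.1 (lt_of_le_of_ne hy.2 h.2)
  exact hyJ (hJ.out ha hb ⟨hay.le, hyb.le⟩)

end Valuation

end PiecesAndValuations

/-! ### Reasoning about protocols -/

section Protocols

open Set

/-- Every run of the protocol `p` with truthful agents takes at most `N` queries, and its output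
satisfies `Q`. -/
def Ensures {α : Type} (V : Profile) (N : ℕ) (Q : α → Prop) (p : Protocol α) : Prop :=
  ∀ n a, p.Run V n a → n ≤ N ∧ Q a

section Ensures

variable {α β ι : Type} {V : Profile} {M N : ℕ}

theorem Protocol.Run.of_bind {p : Protocol α} {f : α → Protocol β} {n : ℕ} {b : β}
    (h : (p.bind f).Run V n b) :
    ∃ n₁ n₂ a, p.Run V n₁ a ∧ (f a).Run V n₂ b ∧ n = n₁ + n₂ := by
  induction p generalizing n with
  | ret a => exact ⟨0, n, a, .ret a, h, (Nat.zero_add n).symm⟩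
  | eval i x y k ih =>
    cases h with
    | eval h =>
      obtain ⟨n₁, n₂, a, h₁, h₂, rfl⟩ := ih _ h
      exact ⟨n₁ + 1, n₂, a, .eval h₁, h₂, by omega⟩
  | cut i x r k ih =>
    cases h with
    | cut hz h =>
      obtain ⟨n₁, n₂, a, h₁, h₂, rfl⟩ := ih _ h
      exact ⟨n₁ + 1, n₂, a, .cut hz h₁, h₂, by omega⟩

theorem Ensures.mono {Q Q' : α → Prop} {p : Protocol α} (h : Ensures V M Q p) (hMN : M ≤ N)
    (hQ : ∀ a, Q a → Q' a) : Ensures V N Q' p := fun n a hr =>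
  ⟨(h n a hr).1.trans hMN, hQ a (h n a hr).2⟩

theorem Ensures.ret {Q : α → Prop} {a : α} (h : Q a) : Ensures V N Q (.ret a) := by
  intro n b hr
  cases hr
  exact ⟨Nat.zero_le _, h⟩

theorem Ensures.bind {Q : α → Prop} {S : β → Prop} {p : Protocol α} {f : α → Protocol β}
    (hp : Ensures V M Q p) (hf : ∀ a, Q a → Ensures V N S (f a)) :
    Ensures V (M + N) S (p.bind f) := by
  intro n b hr
  obtain ⟨n₁, n₂, a, h₁, h₂, rfl⟩ := hr.of_bind
  obtain ⟨hn₁, ha⟩ := hp _ _ h₁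
  obtain ⟨hn₂, hb⟩ := hf a ha _ _ h₂
  exact ⟨add_le_add hn₁ hn₂, hb⟩

/-- Run the protocols `p i` for all `i` in a list, and collect their outputs. -/
noncomputable def tableList [DecidableEq ι] [Inhabited α] (p : ι → Protocol α) :
    List ι → Protocol (ι → α)
  | [] => .ret fun _ => default
  | i :: l => (p i).bind fun a => (tableList p l).bind fun g => .ret (Function.update g i a)

open Classical in
/-- Run the protocols `p i` for all `i` in a finite type, and collect their outputs. -/
noncomputable def table [Fintype ι] [Inhabited α] (p : ι → Protocol α) : Protocol (ι → α) :=
  tableList p Finset.univ.toList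

theorem Ensures.tableList [DecidableEq ι] [Inhabited α] {p : ι → Protocol α} {Q : ι → α → Prop}
    (hp : ∀ i, Ensures V N (Q i) (p i)) (l : List ι) :
    Ensures V (l.length * N) (fun g => ∀ i ∈ l, Q i (g i)) (tableList p l) := by
  induction l with
  | nil => exact .ret (by simp)
  | cons i l ih =>
    refine Ensures.mono ((hp i).bind (N := l.length * N + 0) fun a ha => ih.bind fun g hg =>
      .ret (Q := fun g : ι → α => ∀ j ∈ i :: l, Q j (g j)) ?_) ?_ fun _ h => h
    · intro j hj
      by_cases hji : j = i
      · subst hji; simpa using ha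
      · rw [Function.update_of_ne hji]
        exact hg j (by simpa [hji] using hj)
    · rw [List.length_cons, Nat.succ_mul]; omega

theorem Ensures.table [Fintype ι] [Inhabited α] {p : ι → Protocol α} {Q : ι → α → Prop}
    (hp : ∀ i, Ensures V N (Q i) (p i)) :
    Ensures V (Fintype.card ι * N) (fun g => ∀ i, Q i (g i)) (table p) := by
  classical
  refine (Ensures.tableList hp Finset.univ.toList).mono (by simp) fun g hg i => hg i (by simp)

end Ensures

/-! ### Evaluating and cutting pieces that consist of several intervals -/

open Classical in
/-- A family of disjoint intervals that make up the piece `X`, as small as possible (and empty if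
`X` is not a piece). -/
noncomputable def intervals (X : Set Cake) : Finset (Set Cake) :=
  if h : IsPiece X then h.exists_disjoint_family.choose else ∅

theorem intervals_spec {X : Set Cake} (h : IsPiece X) :
    (∀ J ∈ intervals X, J.OrdConnected) ∧ ⋃₀ (intervals X : Set (Set Cake)) = X ∧
      (∀ I ∈ intervals X, ∀ J ∈ intervals X, I ≠ J → Disjoint I J) ∧
      ∀ m, IsPieceOf m X → (intervals X).card ≤ m := by
  rw [intervals, dif_pos h]
  exact h.exists_disjoint_family.choose_spec

/-- Ask agent `i` for the values of all intervals in a list, and add up the replies. -/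
noncomputable def evalList (i : Agent) : List (Set Cake) → Protocol ℝ
  | [] => .ret 0
  | J :: l => .eval i (sInf J) (sSup J) fun a => (evalList i l).bind fun b => .ret (a + b)

/-- Find out the value of the piece `X` to agent `i`. -/
noncomputable def evalPiece (i : Agent) (X : Set Cake) : Protocol ℝ :=
  evalList i (intervals X).toList

variable {V : Profile}

theorem ensures_evalList (i : Agent) (l : List (Set Cake)) (hl : ∀ J ∈ l, J.OrdConnected) :
    Ensures V l.length (· = (l.map (V i).val).sum) (evalList i l) := by
  induction l with
  | nil => exact .ret (by simp)
  | cons J l ih =>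
    intro n a hr
    cases hr with
    | eval hr =>
      have := (ih fun K hK => hl K (List.mem_cons_of_mem _ hK)).bind (N := 0)
        (f := fun b => .ret ((V i).val (Icc (sInf J) (sSup J)) + b))
        (S := (· = ((J :: l).map (V i).val).sum)) (fun b hb => .ret (by
          rw [List.map_cons, List.sum_cons, hb,
            (V i).val_ordConnected (hl J List.mem_cons_self)])) _ _ hr
      exact ⟨by rw [List.length_cons]; omega, this.2⟩

theorem ensures_evalPiece {m : ℕ} {X : Set Cake} (hX : IsPieceOf m X) (i : Agent) :
    Ensures V m (· = (V i).val X) (evalPiece i X) := by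
  obtain ⟨h1, h2, h3, h4⟩ := intervals_spec hX.isPiece
  refine (ensures_evalList i _ fun J hJ => h1 J (Finset.mem_toList.1 hJ)).mono
    (by simpa using h4 m hX) fun a ha => ?_
  rw [ha, Finset.sum_map_toList, ← (V i).val_sUnion _ h1 h3, h2]

open Classical in
/-- The end points of the intervals that make up `X`, and the left end point of the cake. -/
noncomputable def endpoints (X : Set Cake) : Finset Cake :=
  insert 0 ((intervals X).image sInf ∪ (intervals X).image sSup)

theorem card_endpoints_le {m : ℕ} {X : Set Cake} (hX : IsPieceOf m X) :
    (endpoints X).card ≤ 2 * m + 1 := by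
  classical
  have h := (intervals_spec hX.isPiece).2.2.2 m hX
  have h1 := Finset.card_insert_le (0 : Cake)
    ((intervals X).image sInf ∪ (intervals X).image sSup)
  have h2 := Finset.card_union_le ((intervals X).image sInf) ((intervals X).image sSup)
  have h3 := Finset.card_image_le (s := intervals X) (f := sInf)
  have h4 := Finset.card_image_le (s := intervals X) (f := sSup)
  unfold endpoints
  omega

/-- Between two neighbouring end points there is either nothing of `X` or no gap in `X`. -/
theorem disjoint_or_subset_of_endpoints {X : Set Cake} (hX : IsPiece X) {a b : Cake}
    (hab : ∀ e ∈ endpoints X, e ≤ a ∨ b ≤ e) : Disjoint (Ioo a b) X ∨ Ioo a b ⊆ X := by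
  classical
  obtain ⟨h1, h2, -, -⟩ := intervals_spec hX
  by_contra! h
  obtain ⟨hd, hs⟩ := h
  obtain ⟨x, hx, hxX⟩ := not_disjoint_iff.1 hd
  rw [← h2] at hxX
  obtain ⟨J, hJ, hxJ⟩ := hxX
  have hinf : sInf J ∈ endpoints X := Finset.mem_insert_of_mem
    (Finset.mem_union_left _ (Finset.mem_image_of_mem _ hJ))
  have hsup : sSup J ∈ endpoints X := Finset.mem_insert_of_mem
    (Finset.mem_union_right _ (Finset.mem_image_of_mem _ hJ))
  have hia : sInf J ≤ a := (hab _ hinf).resolve_right fun h =>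
    ((sInf_le hxJ).trans_lt hx.2).not_ge h
  have hbs : b ≤ sSup J := (hab _ hsup).resolve_left fun h =>
    (hx.1.trans_le (le_sSup hxJ)).not_ge h
  refine hs fun y hy => ?_
  obtain ⟨c, hc, hcy⟩ := sInf_lt_iff.1 (hia.trans_lt hy.1)
  obtain ⟨d, hd, hyd⟩ := lt_sSup_iff.1 (hy.2.trans_le hbs)
  rw [← h2]
  exact ⟨J, hJ, (h1 J hJ).out hc hd ⟨hcy.le, hyd.le⟩⟩

open Classical in
/-- Find a point such that the part of `X` to the left of it has value `r` to agent `i`: the last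
end point `e` before which the value does not exceed `r` is found by evaluations, and then one cut
query is asked that starts at `e`. -/
noncomputable def cutPiece (i : Agent) (X : Set Cake) (r : ℝ) : Protocol Cake :=
  (table fun e : endpoints X => evalPiece i (X ∩ Iic e.1)).bind fun G =>
    if h : (Finset.univ.filter fun e => G e ≤ r).Nonempty then
      let e := (Finset.univ.filter fun e => G e ≤ r).max' h
      if G e = r then .ret e.1 else .cut i e.1 (r - G e) fun z => .ret (z.getD 0)
    else .ret 0

theorem val_inter_Iic_eq_add (v : Valuation) {X : Set Cake} (hX : IsPiece X) {x y : Cake}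
    (h : x ≤ y) : v.val (X ∩ Iic y) = v.val (X ∩ Iic x) + v.val (X ∩ Ioo x y) := by
  have h1 : v.val (X ∩ Ioo x y) = v.val (X ∩ Ioc x y) :=
    v.val_eq_of_subset_insert (a := y) (b := y) (hX.inter_ordConnected ordConnected_Ioo)
      (hX.inter_ordConnected ordConnected_Ioc) (inter_subset_inter_right _ Ioo_subset_Ioc_self) (by
        rintro z ⟨hzX, hz⟩ hz'
        exact .inl (le_antisymm hz.2 (not_lt.1 fun h => hz' ⟨hzX, hz.1, h⟩)))
  rw [h1, ← Iic_union_Ioc_eq_Iic h, inter_union_distrib_left]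
  refine v.additive _ _ (hX.inter_ordConnected ordConnected_Iic)
    (hX.inter_ordConnected ordConnected_Ioc) ?_
  exact disjoint_left.2 fun z hz hz' => hz.2.not_gt hz'.2.1

theorem ensures_cutPiece {m : ℕ} {X : Set Cake} (hX : IsPieceOf m X) (i : Agent) {r : ℝ}
    (hr : 0 ≤ r) (hrX : r ≤ (V i).val X) :
    Ensures V ((2 * m + 1) * m + 1) (fun t => (V i).val (X ∩ Iic t) = r) (cutPiece i X r) := by
  classical
  have htab := Ensures.table (V := V) (fun e : endpoints X =>
    ensures_evalPiece (hX.inter_ordConnected (I := Iic e.1) ordConnected_Iic) i)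
  rw [Fintype.card_coe] at htab
  refine (htab.mono (Nat.mul_le_mul_right m (card_endpoints_le hX)) fun _ h => h).bind (N := 1)
    fun G hG => ?_
  have h0 : (0 : Cake) ∈ endpoints X := Finset.mem_insert_self _ _
  have hne : (Finset.univ.filter fun e => G e ≤ r).Nonempty := by
    refine ⟨⟨0, h0⟩, Finset.mem_filter.2 ⟨Finset.mem_univ _, ?_⟩⟩
    rw [hG, (V i).val_subsingleton]
    · exact hr
    · intro a ha b hb
      exact (le_bot_iff.1 ha.2).trans (le_bot_iff.1 hb.2).symm
  rw [dif_pos hne]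
  set e := (Finset.univ.filter fun e => G e ≤ r).max' hne
  have heG : G e ≤ r := (Finset.mem_filter.1 (Finset.max'_mem _ hne)).2
  have hmax : ∀ e' : endpoints X, G e' ≤ r → e' ≤ e := fun e' h =>
    Finset.le_max' _ e' (by simpa using h)
  simp only
  split_ifs with heq
  · exact .ret (by rw [← hG, heq])
  have hpos : 0 < r - G e := sub_pos.2 (lt_of_le_of_ne heG heq)
  -- Let `b` be the next end point, or the end of the cake if there is none.
  obtain ⟨b, hb, heb, hbG⟩ : ∃ b : Cake, (∀ e' ∈ endpoints X, e' ≤ e.1 ∨ b ≤ e') ∧ e.1 ≤ b ∧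
      r ≤ (V i).val (X ∩ Iic b) := by
    by_cases hlast : ∃ e' : endpoints X, e < e'
    · have hne' : (Finset.univ.filter fun e' => e < e').Nonempty := by
        obtain ⟨e', h⟩ := hlast
        exact ⟨e', by simpa using h⟩
      have hlt : e < (Finset.univ.filter fun e' => e < e').min' hne' :=
        (Finset.mem_filter.1 (Finset.min'_mem _ hne')).2
      refine ⟨((Finset.univ.filter fun e' => e < e').min' hne').1, fun e' he' => ?_, hlt.le, ?_⟩
      · by_cases h : e < (⟨e', he'⟩ : endpoints X)
        · exact .inr (Finset.min'_le (Finset.univ.filter fun e' => e < e') (⟨e', he'⟩ : endpoints X)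
            (by simpa using h))
        · exact .inl (not_lt.1 h)
      · rw [← hG]
        exact (not_le.1 fun h => (hmax _ h).not_gt hlt).le
    · push Not at hlast
      refine ⟨1, fun e' he' => .inl (hlast ⟨e', he'⟩), le_top, ?_⟩
      have : (Iic (1 : Cake)) = univ := Iic_top
      rwa [this, inter_univ]
  have hadd := val_inter_Iic_eq_add (V i) hX.isPiece heb
  rw [← hG] at hadd
  have hsub : Ioo e.1 b ⊆ X := by
    refine (disjoint_or_subset_of_endpoints hX.isPiece hb).resolve_left fun h => ?_
    rw [inter_comm X (Ioo _ _), h.inter_eq, (V i).val_empty] at hadd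
    linarith
  rw [inter_eq_self_of_subset_right hsub, (V i).val_Ioo] at hadd
  intro n t hrun
  cases hrun with
  | cut hz hrun =>
    cases hrun
    refine ⟨le_rfl, ?_⟩
    rename_i z
    cases z with
    | none => exact absurd ((V i).exists_val_Icc_eq heb hpos (by linarith)) hz
    | some y =>
      obtain ⟨hey, hy⟩ := hz
      have h1 := val_inter_Iic_eq_add (V i) hX.isPiece hey
      -- A reply beyond `b` is possible if nothing of value lies between `b` and the reply.
      rcases le_total y b with hyb | hby
      · rw [inter_eq_self_of_subset_right ((Ioo_subset_Ioo_right hyb).trans hsub),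
          (V i).val_Ioo, hy, ← hG] at h1
        simp only [Option.getD_some]
        linarith
      · have h2 : (V i).val (X ∩ Ioo e.1 y) ≤ (V i).val (Icc e.1 y) :=
          (V i).val_mono (isPiece_of_ordConnected ordConnected_Icc)
            (hX.isPiece.inter_ordConnected ordConnected_Ioo)
            (inter_subset_right.trans Ioo_subset_Icc_self)
        have h3 : (V i).val (X ∩ Iic b) ≤ (V i).val (X ∩ Iic y) :=
          (V i).val_mono (hX.isPiece.inter_ordConnected ordConnected_Iic)
            (hX.isPiece.inter_ordConnected ordConnected_Iic)
            (inter_subset_inter_right _ (Iic_subset_Iic.2 hby))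
        rw [hy] at h2
        rw [← hG] at h1
        simp only [Option.getD_some]
        linarith

/-! ### Trimming -/

/-- What is left of the piece `P` after everything up to and including the point `τ` has been
trimmed off; `τ = ⊥` leaves the piece complete. -/
def trim (P : Set Cake) (τ : WithBot Cake) : Set Cake := {x ∈ P | τ < (x : WithBot Cake)}

theorem trim_subset (P : Set Cake) (τ : WithBot Cake) : trim P τ ⊆ P := fun _ h => h.1

@[simp] theorem trim_bot (P : Set Cake) : trim P ⊥ = P := by
  ext x
  simp [trim]

theorem ordConnected_trim_set (τ : WithBot Cake) :
    {x : Cake | τ < (x : WithBot Cake)}.OrdConnected :=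
  ⟨fun _ hx _ _ _ hz => lt_of_lt_of_le hx (WithBot.coe_le_coe.2 hz.1)⟩

theorem IsPieceOf.trim {m : ℕ} {P : Set Cake} (hP : IsPieceOf m P) (τ : WithBot Cake) :
    IsPieceOf m (trim P τ) :=
  hP.inter_ordConnected (ordConnected_trim_set τ)

theorem IsPiece.trim {P : Set Cake} (hP : IsPiece P) (τ : WithBot Cake) : IsPiece (trim P τ) :=
  hP.inter_ordConnected (ordConnected_trim_set τ)

theorem diff_trim (P : Set Cake) (τ : WithBot Cake) :
    P \ CakeCutting.trim P τ = P ∩ {x : Cake | (x : WithBot Cake) ≤ τ} := by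
  ext x
  simp only [CakeCutting.trim, Set.mem_sdiff, mem_ofPred_eq, not_and, not_lt, mem_inter_iff]
  tauto

theorem IsPieceOf.diff_trim {m : ℕ} {P : Set Cake} (hP : IsPieceOf m P) (τ : WithBot Cake) :
    IsPieceOf m (P \ CakeCutting.trim P τ) := by
  rw [CakeCutting.diff_trim]
  exact hP.inter_ordConnected
    ⟨fun _ _ _ hy _ hz => (WithBot.coe_le_coe.2 hz.2).trans hy⟩

theorem trim_anti (P : Set Cake) {σ τ : WithBot Cake} (h : σ ≤ τ) :
    trim P τ ⊆ trim P σ := fun _ hx => ⟨hx.1, h.trans_lt hx.2⟩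

theorem val_trim_coe (v : Valuation) {P : Set Cake} (hP : IsPiece P) (t : Cake) :
    v.val (trim P t) = v.val P - v.val (P ∩ Iic t) := by
  have h1 : trim P t = P \ (P ∩ Iic t) := by
    ext x
    simp only [trim, mem_ofPred_eq, WithBot.coe_lt_coe, Set.mem_sdiff, mem_inter_iff, mem_Iic, not_and,
      not_le]
    tauto
  rw [h1]
  linarith [v.val_diff_add hP (hP.inter_ordConnected (ordConnected_Iic (a := t)))
    inter_subset_left]

/-- `τ` is a place where somebody who values trimmed versions of a piece by `g` would trim this
piece to the value `r`; nothing is trimmed off if the piece is worth at most `r` anyway. -/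
def IsTrimTo {T : Type} [LE T] [OrderBot T] (g : T → ℝ) (r : ℝ) (τ : T) : Prop :=
  g τ = min r (g ⊥) ∧ (g ⊥ ≤ r → τ = ⊥)

open Classical in
/-- Ask agent `i` to trim the piece `X` to the value `r`. -/
noncomputable def trimTo (i : Agent) (X : Set Cake) (r : ℝ) : Protocol (WithBot Cake) :=
  (evalPiece i X).bind fun v =>
    if v ≤ r then .ret ⊥ else (cutPiece i X (v - r)).bind fun t => .ret t

theorem ensures_trimTo {m : ℕ} {X : Set Cake} (hX : IsPieceOf m X) (i : Agent) {r : ℝ}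
    (hr : 0 ≤ r) :
    Ensures V (m + ((2 * m + 1) * m + 1))
      (fun τ => IsTrimTo (fun σ => (V i).val (trim X σ)) r τ) (trimTo i X r) := by
  refine (ensures_evalPiece hX i).bind ?_
  rintro _ rfl
  split_ifs with h
  · exact .ret ⟨by simp [h], fun _ => rfl⟩
  · refine (ensures_cutPiece hX i (by linarith) (by linarith)).bind (N := 0) fun t ht =>
      .ret ⟨?_, ?_⟩
    · simp only [trim_bot]
      rw [val_trim_coe _ hX.isPiece, ht, min_eq_left (le_of_not_ge h)]
      ring
    · simp only [trim_bot]
      exact fun h' => absurd h' h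

end Protocols

/-! ### The combinatorics of trimming -/

theorem exists_equiv_fin_four {c x y z : Fin 4} (hcx : c ≠ x) (hcy : c ≠ y) (hcz : c ≠ z)
    (hxy : x ≠ y) (hxz : x ≠ z) (hyz : y ≠ z) :
    ∃ e : Fin 4 ≃ Fin 4, e 0 = c ∧ e 1 = x ∧ e 2 = y ∧ e 3 = z := by
  have hinj : Function.Injective ![c, x, y, z] := by
    intro i j h
    fin_cases i <;> fin_cases j <;> simp_all
  exact ⟨Equiv.ofBijective _ (Finite.injective_iff_bijective.1 hinj), rfl, rfl, rfl, rfl⟩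

/-- Four different agents can be assigned to four different pieces in any prescribed way. -/
theorem exists_assign {c x y z s r p q : Fin 4} (hcx : c ≠ x) (hcy : c ≠ y) (hcz : c ≠ z)
    (hxy : x ≠ y) (hxz : x ≠ z) (hyz : y ≠ z) (hsr : s ≠ r) (hsp : s ≠ p) (hsq : s ≠ q)
    (hrp : r ≠ p) (hrq : r ≠ q) (hpq : p ≠ q) :
    ∃ e : Fin 4 ≃ Fin 4, e c = s ∧ e x = r ∧ e y = p ∧ e z = q := by
  obtain ⟨e, rfl, rfl, rfl, rfl⟩ := exists_equiv_fin_four hcx hcy hcz hxy hxz hyz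
  obtain ⟨f, rfl, rfl, rfl, rfl⟩ := exists_equiv_fin_four hsr hsp hsq hrp hrq hpq
  exact ⟨e.symm.trans f, by simp⟩

theorem eq_of_four {c x y z : Fin 4} (hcx : c ≠ x) (hcy : c ≠ y) (hcz : c ≠ z)
    (hxy : x ≠ y) (hxz : x ≠ z) (hyz : y ≠ z) (i : Fin 4) : i = c ∨ i = x ∨ i = y ∨ i = z := by
  obtain ⟨e, rfl, rfl, rfl, rfl⟩ := exists_equiv_fin_four hcx hcy hcz hxy hxz hyz
  obtain ⟨j, rfl⟩ := e.surjective i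
  fin_cases j <;> simp

/-- Apart from piece `o`, nothing is worth more than piece `k`, where piece `l` has value
`u l`: somebody who holds `o` and has to give it away would like to have `k` instead. -/
def SecondChoice (u : Fin 4 → ℝ) (o k : Fin 4) : Prop := k ≠ o ∧ ∀ l, l ≠ o → u l ≤ u k

theorem exists_secondChoice (u : Fin 4 → ℝ) (o : Fin 4) : ∃ k, SecondChoice u o k := by
  obtain ⟨k, hk, h⟩ := (Finset.univ.erase o).exists_max_image u
    ⟨o + 1, by simp⟩
  exact ⟨k, Finset.ne_of_mem_erase hk, fun l hl => h l (by simp [hl])⟩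

/-- A way to trim and assign four pieces, as needed for a core protocol. Here `v i k` and `u i k`
are the values of piece `k` to agent `i` before and after trimming, `full k` means that piece `k` is
complete, and agent `i` receives piece `a i`. The last condition prepares the reallocation: the
holder of a trimmed piece can be made to give it away in such a way that everybody (except for the
cutter, who keeps a complete piece) either keeps her piece or receives a second choice. -/
structure GoodTrim (c : Agent) (v u : Agent → Fin 4 → ℝ) (full : Fin 4 → Prop)
    (a : Agent ≃ Fin 4) : Prop where
  cutter : full (a c)
  other : ∃ i, i ≠ c ∧ full (a i)
  envyFree : ∀ i, i ≠ c → ∀ k, u i k ≤ u i (a i)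
  preferred : (∃ τ : Agent ≃ Fin 4, ∀ i, i ≠ c → ∀ k, v i k ≤ v i (τ i)) → ∀ k, full k
  swap : ∀ k, ¬ full k → ∃ σ : Agent ≃ Fin 4, full (σ c) ∧ σ (a.symm k) ≠ k ∧
    ∀ i, i ≠ c → ∀ l, l ≠ a i → u i l ≤ u i (σ i)

section swap

variable {c x y z s r p q : Fin 4} {u : Fin 4 → Fin 4 → ℝ} {full : Fin 4 → Prop}

/-- Following the second choices from a holder of a complete piece to agent `y`, and then on from
`y`, closes a cycle, possibly by way of the cutter, who is content with any complete piece. -/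
theorem exists_swap_of_secondChoice (hcx : c ≠ x) (hcy : c ≠ y) (hcz : c ≠ z)
    (hxy : x ≠ y) (hxz : x ≠ z) (hyz : y ≠ z) (hsr : s ≠ r) (hsp : s ≠ p) (hsq : s ≠ q)
    (hrp : r ≠ p) (hrq : r ≠ q) (hpq : p ≠ q)
    (hx : ∀ l, u x l ≤ u x r) (hz : ∀ l, u z l ≤ u z q) (hs : full s) (hr : full r)
    (hxp : SecondChoice (u x) r p) :
    ∃ σ : Fin 4 ≃ Fin 4, full (σ c) ∧ σ y ≠ p ∧ (∀ l, l ≠ r → u x l ≤ u x (σ x)) ∧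
      (∀ l, l ≠ p → u y l ≤ u y (σ y)) ∧ (∀ l, l ≠ q → u z l ≤ u z (σ z)) := by
  obtain ⟨k, hkp, hk⟩ := exists_secondChoice (u y) p
  rcases eq_of_four hsr hsp hsq hrp hrq hpq k with rfl | rfl | rfl | rfl
  · obtain ⟨e, h1, h2, h3, h4⟩ := exists_assign hcx hcy hcz hxy hxz hyz hrp hsr.symm hrq
      hsp.symm hpq hsq
    exact ⟨e, by rwa [h1], by rwa [h3], by rw [h2]; exact hxp.2, by rwa [h3],
      by rw [h4]; exact fun l _ => hz l⟩
  · obtain ⟨e, h1, h2, h3, h4⟩ := exists_assign hcx hcy hcz hxy hxz hyz hsp hsr hsq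
      hrp.symm hpq hrq
    exact ⟨e, by rwa [h1], by rwa [h3], by rw [h2]; exact hxp.2, by rwa [h3],
      by rw [h4]; exact fun l _ => hz l⟩
  · exact absurd rfl hkp
  · obtain ⟨k', hkq, hk'⟩ := exists_secondChoice (u z) k
    rcases eq_of_four hsr hsp hsq hrp hrq hpq k' with rfl | rfl | rfl | rfl
    · obtain ⟨e, h1, h2, h3, h4⟩ := exists_assign hcx hcy hcz hxy hxz hyz hrp hrq hsr.symm
        hpq hsp.symm hsq.symm
      exact ⟨e, by rwa [h1], by rwa [h3], by rw [h2]; exact hxp.2, by rwa [h3], by rwa [h4]⟩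
    · obtain ⟨e, h1, h2, h3, h4⟩ := exists_assign hcx hcy hcz hxy hxz hyz hsp hsq hsr
        hpq hrp.symm hrq.symm
      exact ⟨e, by rwa [h1], by rwa [h3], by rw [h2]; exact hxp.2, by rwa [h3], by rwa [h4]⟩
    · obtain ⟨e, h1, h2, h3, h4⟩ := exists_assign hcx hcy hcz hxy hxz hyz hsr hsq hsp
        hrq hrp hpq.symm
      exact ⟨e, by rwa [h1], by rwa [h3], by rw [h2]; exact fun l _ => hx l, by rwa [h3],
        by rwa [h4]⟩
    · exact absurd rfl hkq

/-- As `exists_swap_of_secondChoice`, in case the second choices lead to agent `y` by way of `z`,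
or agents `y` and `z` have second choices in each other's pieces. -/
theorem exists_swap (hcx : c ≠ x) (hcy : c ≠ y) (hcz : c ≠ z)
    (hxy : x ≠ y) (hxz : x ≠ z) (hyz : y ≠ z) (hsr : s ≠ r) (hsp : s ≠ p) (hsq : s ≠ q)
    (hrp : r ≠ p) (hrq : r ≠ q) (hpq : p ≠ q)
    (hx : ∀ l, u x l ≤ u x r) (hz : ∀ l, u z l ≤ u z q) (hs : full s) (hr : full r)
    (h : SecondChoice (u x) r p ∨ SecondChoice (u z) q p ∧
      (SecondChoice (u x) r q ∨ full q ∨ SecondChoice (u y) p q)) :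
    ∃ σ : Fin 4 ≃ Fin 4, full (σ c) ∧ σ y ≠ p ∧ (∀ l, l ≠ r → u x l ≤ u x (σ x)) ∧
      (∀ l, l ≠ p → u y l ≤ u y (σ y)) ∧ (∀ l, l ≠ q → u z l ≤ u z (σ z)) := by
  have hswap : SecondChoice (u z) q p → SecondChoice (u y) p q →
      ∃ σ : Fin 4 ≃ Fin 4, full (σ c) ∧ σ y ≠ p ∧ (∀ l, l ≠ r → u x l ≤ u x (σ x)) ∧
        (∀ l, l ≠ p → u y l ≤ u y (σ y)) ∧ (∀ l, l ≠ q → u z l ≤ u z (σ z)) := by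
    intro hzp hyq
    obtain ⟨e, h1, h2, h3, h4⟩ := exists_assign hcx hcy hcz hxy hxz hyz hsr hsq hsp
      hrq hrp hpq.symm
    exact ⟨e, by rwa [h1], by rw [h3]; exact hpq.symm, by rw [h2]; exact fun l _ => hx l,
      by rw [h3]; exact hyq.2, by rw [h4]; exact hzp.2⟩
  rcases h with h | ⟨hzp, hxq | hq | hyq⟩
  · exact exists_swap_of_secondChoice hcx hcy hcz hxy hxz hyz hsr hsp hsq hrp hrq hpq hx hz hs hr h
  · obtain ⟨k, hkp, hk⟩ := exists_secondChoice (u y) p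
    rcases eq_of_four hsr hsp hsq hrp hrq hpq k with rfl | rfl | rfl | rfl
    · obtain ⟨e, h1, h2, h3, h4⟩ := exists_assign hcx hcy hcz hxy hxz hyz hrq hsr.symm hrp
        hsq.symm hpq.symm hsp
      exact ⟨e, by rwa [h1], by rwa [h3], by rw [h2]; exact hxq.2, by rwa [h3],
        by rw [h4]; exact hzp.2⟩
    · obtain ⟨e, h1, h2, h3, h4⟩ := exists_assign hcx hcy hcz hxy hxz hyz hsq hsr hsp
        hrq.symm hpq.symm hrp
      exact ⟨e, by rwa [h1], by rwa [h3], by rw [h2]; exact hxq.2, by rwa [h3],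
        by rw [h4]; exact hzp.2⟩
    · exact absurd rfl hkp
    · exact hswap hzp ⟨hkp, hk⟩
  · obtain ⟨σ, h1, h2, h3, h4, h5⟩ := exists_swap_of_secondChoice hcz hcy hcx hyz.symm hxz.symm
      hxy.symm hsq hsp hsr hpq.symm hrq.symm hrp.symm hz hx hs hq hzp
    exact ⟨σ, h1, h2, h5, h4, h3⟩
  · exact hswap hzp hyq

/-- If piece `s` goes to the cutter, `r` to agent `x`, and the possibly trimmed pieces `p` and `q`
go to agents `y` and `z`, then it suffices to check that nobody envies another agent, and that each
trimmed piece can be reached along second choices. -/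
theorem exists_goodTrim {v : Fin 4 → Fin 4 → ℝ} (hcx : c ≠ x) (hcy : c ≠ y) (hcz : c ≠ z)
    (hxy : x ≠ y) (hxz : x ≠ z) (hyz : y ≠ z) (hsr : s ≠ r) (hsp : s ≠ p) (hsq : s ≠ q)
    (hrp : r ≠ p) (hrq : r ≠ q) (hpq : p ≠ q)
    (hpref : ¬ ∃ τ : Agent ≃ Fin 4, ∀ i, i ≠ c → ∀ k, v i k ≤ v i (τ i))
    (hs : full s) (hr : full r)
    (hx : ∀ l, u x l ≤ u x r) (hy : ∀ l, u y l ≤ u y p) (hz : ∀ l, u z l ≤ u z q)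
    (hp : full p ∨ SecondChoice (u x) r p ∨ SecondChoice (u z) q p ∧
      (SecondChoice (u x) r q ∨ full q ∨ SecondChoice (u y) p q))
    (hq : full q ∨ SecondChoice (u x) r q ∨ SecondChoice (u y) p q ∧
      (SecondChoice (u x) r p ∨ full p ∨ SecondChoice (u z) q p)) :
    ∃ a, GoodTrim c v u full a := by
  obtain ⟨a, h1, h2, h3, h4⟩ := exists_assign hcx hcy hcz hxy hxz hyz hsr hsp hsq hrp hrq hpq
  have hagent := eq_of_four hcx hcy hcz hxy hxz hyz
  refine ⟨a, by rwa [h1], ⟨x, hcx.symm, by rwa [h2]⟩, ?_, fun h => absurd h hpref, ?_⟩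
  · intro i hi k
    rcases hagent i with rfl | rfl | rfl | rfl
    exacts [absurd rfl hi, h2 ▸ hx k, h3 ▸ hy k, h4 ▸ hz k]
  · intro k hk
    rcases eq_of_four hsr hsp hsq hrp hrq hpq k with rfl | rfl | rfl | rfl
    · exact absurd hs hk
    · exact absurd hr hk
    · obtain ⟨σ, g1, g2, g3, g4, g5⟩ := exists_swap hcx hcy hcz hxy hxz hyz hsr hsp hsq hrp hrq hpq
        hx hz hs hr (hp.resolve_left hk)
      refine ⟨σ, g1, by rwa [← h3, Equiv.symm_apply_apply, h3], fun i hi => ?_⟩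
      rcases hagent i with rfl | rfl | rfl | rfl
      exacts [absurd rfl hi, by rwa [h2], by rwa [h3], by rwa [h4]]
    · obtain ⟨σ, g1, g2, g3, g4, g5⟩ := exists_swap hcx hcz hcy hxz hxy hyz.symm hsr hsq hsp hrq hrp
        hpq.symm hx hy hs hr (hq.resolve_left hk)
      refine ⟨σ, g1, by rwa [← h4, Equiv.symm_apply_apply, h4], fun i hi => ?_⟩
      rcases hagent i with rfl | rfl | rfl | rfl
      exacts [absurd rfl hi, by rwa [h2], by rwa [h3], by rwa [h4]]

end swap

/-! ### A contest for two pieces -/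

section contest

variable {T : Type} [LinearOrder T] [OrderBot T] {c x y z s r p q : Fin 4}

/-- Three agents compete for a piece, which is worth `h i τ` to agent `i` when trimmed at `τ`, and
agent `i` has an alternative of value `w i`. If the piece is trimmed at `t₂`, then agent `a₁` still
wants it, `a₂` is indifferent and `a₃` prefers her alternative; trimming at `t₃` is just enough to
make `a₃` indifferent (or is no trimming at all). -/
structure IsRanked (h : Agent → T → ℝ) (w : Agent → ℝ) (a₁ a₂ a₃ : Agent) (t₂ t₃ : T) : Prop where
  le : t₃ ≤ t₂
  first : w a₁ ≤ h a₁ t₂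
  second : h a₂ t₂ = w a₂
  third : h a₃ t₃ ≤ w a₃
  third' : t₃ = ⊥ ∨ h a₃ t₃ = w a₃

theorem IsTrimTo.le {h : T → ℝ} {w : ℝ} {t : T} (ht : IsTrimTo h w t) : h t ≤ w :=
  ht.1 ▸ min_le_left _ _

theorem IsTrimTo.eq_of_le {h : T → ℝ} {w : ℝ} {t : T} (ht : IsTrimTo h w t) (hw : w ≤ h ⊥) :
    h t = w := ht.1.trans (min_eq_left hw)

theorem IsTrimTo.eq_bot_or {h : T → ℝ} {w : ℝ} {t : T} (ht : IsTrimTo h w t) :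
    t = ⊥ ∨ h t = w := by
  rcases le_total (h ⊥) w with hw | hw
  exacts [.inl (ht.2 hw), .inr (ht.eq_of_le hw)]

theorem exists_fourth (c x y : Fin 4) : ∃ z, z ≠ c ∧ z ≠ x ∧ z ≠ y := by
  revert c x y; decide

/-- Sorting the trims of three agents, at least two of whom like the untrimmed piece at least as
much as their alternatives, gives a ranking. -/
theorem exists_isRanked {h : Agent → T → ℝ} (hanti : ∀ i, Antitone (h i)) {w : Agent → ℝ}
    {α : Agent → T} (hα : ∀ i, IsTrimTo (h i) (w i) (α i)) {i j : Agent} (hic : i ≠ c)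
    (hjc : j ≠ c) (hij : i ≠ j) (hi : w i ≤ h i ⊥) (hj : w j ≤ h j ⊥) :
    ∃ a₁ a₂ a₃, c ≠ a₁ ∧ c ≠ a₂ ∧ c ≠ a₃ ∧ a₁ ≠ a₂ ∧ a₁ ≠ a₃ ∧ a₂ ≠ a₃ ∧
      IsRanked h w a₁ a₂ a₃ (α a₂) (α a₃) := by
  wlog hji : α j ≤ α i generalizing i j
  · exact this hjc hic hij.symm hj hi (le_of_not_ge hji)
  obtain ⟨k, hkc, hki, hkj⟩ := exists_fourth c i j
  have key : ∀ {a₁ a₂ a₃ : Agent}, α a₃ ≤ α a₂ → α a₂ ≤ α a₁ → w a₁ ≤ h a₁ ⊥ → w a₂ ≤ h a₂ ⊥ →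
      IsRanked h w a₁ a₂ a₃ (α a₂) (α a₃) := fun h32 h21 h1 h2 =>
    ⟨h32, ((hα _).eq_of_le h1) ▸ hanti _ h21, (hα _).eq_of_le h2, (hα _).le, (hα _).eq_bot_or⟩
  by_cases hjk : α k ≤ α j
  · exact ⟨i, j, k, hic.symm, hjc.symm, hkc.symm, hij, hki.symm, hkj.symm, key hjk hji hi hj⟩
  · push Not at hjk
    have hk : w k ≤ h k ⊥ := by
      by_contra! hlt
      exact not_lt_bot ((hα k).2 hlt.le ▸ hjk)
    rcases le_total (α k) (α i) with hle | hle
    · exact ⟨i, k, j, hic.symm, hkc.symm, hjc.symm, hki.symm, hij, hkj, key hjk.le hle hi hk⟩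
    · exact ⟨k, i, j, hkc.symm, hic.symm, hjc.symm, hki, hkj, hij, key hji hle hk hi⟩

variable {g : Agent → Fin 4 → T → ℝ}

/-- Agents `y` and `z` receive the pieces `p` and `q` trimmed at `tp` and `tq`, and agent `x` and
the cutter share the other two pieces `r` and `s`, the better one of which agent `i` values at
`w i`. -/
theorem exists_goodTrim_of_two (hcx : c ≠ x) (hcy : c ≠ y) (hcz : c ≠ z)
    (hxy : x ≠ y) (hxz : x ≠ z) (hyz : y ≠ z) (hsr : s ≠ r) (hsp : s ≠ p) (hsq : s ≠ q)
    (hrp : r ≠ p) (hrq : r ≠ q) (hpq : p ≠ q)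
    (hpref : ¬ ∃ τ : Agent ≃ Fin 4, ∀ i, i ≠ c → ∀ k, g i k ⊥ ≤ g i (τ i) ⊥)
    {w : Agent → ℝ} (hw : ∀ i, w i = max (g i r ⊥) (g i s ⊥)) {tp tq : T}
    (hyp : w y ≤ g y p tp) (hyq : g y q tq ≤ g y p tp)
    (hzq : w z ≤ g z q tq) (hzp : g z p tp ≤ g z q tq)
    (hxp : g x p tp ≤ w x) (hxq : g x q tq ≤ w x)
    (hp : tp = ⊥ ∨ g x p tp = w x ∨
      w z ≤ g z p tp ∧ (g x q tq = w x ∨ tq = ⊥ ∨ w y ≤ g y q tq))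
    (hq : tq = ⊥ ∨ g x q tq = w x ∨
      w y ≤ g y q tq ∧ (g x p tp = w x ∨ tp = ⊥ ∨ w z ≤ g z p tp)) :
    ∃ τ : Fin 4 → T, (∀ k, τ k = ⊥ ∨ τ k = tp ∨ τ k = tq) ∧
      ∃ a, GoodTrim c (fun i k => g i k ⊥) (fun i k => g i k (τ k)) (fun k => τ k = ⊥) a := by
  wlog hsx : g x s ⊥ ≤ g x r ⊥ generalizing r s
  · exact this hsr.symm hrp hrq hsp hsq (fun i => by rw [hw, max_comm]) (le_of_not_ge hsx)
  have hpiece := eq_of_four hsr hsp hsq hrp hrq hpq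
  let τ : Fin 4 → T := fun k => if k = p then tp else if k = q then tq else ⊥
  have τs : τ s = ⊥ := by simp [τ, hsp, hsq]
  have τr : τ r = ⊥ := by simp [τ, hrp, hrq]
  have τp : τ p = tp := by simp [τ]
  have τq : τ q = tq := by simp [τ, hpq.symm]
  have hall : ∀ {P : Fin 4 → Prop}, P s → P r → P p → P q → ∀ k, P k := by
    intro P h1 h2 h3 h4 k
    rcases hpiece k with rfl | rfl | rfl | rfl <;> assumption
  have hwr : ∀ i, g i r ⊥ ≤ w i := fun i => hw i ▸ le_max_left _ _
  have hws : ∀ i, g i s ⊥ ≤ w i := fun i => hw i ▸ le_max_right _ _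
  have hwx : w x = g x r ⊥ := by rw [hw, max_eq_left hsx]
  have hsec : ∀ {i o k : Fin 4}, k ≠ o → (∀ l, l ≠ o → g i l (τ l) ≤ g i k (τ k)) →
      SecondChoice (fun k => g i k (τ k)) o k := fun h₁ h₂ => ⟨h₁, h₂⟩
  have hxp' : g x p tp = w x → SecondChoice (fun k => g x k (τ k)) r p := fun h =>
    hsec hrp.symm (hall (fun _ => by rw [τs, τp, h]; exact hws x) (absurd rfl)
      (fun _ => le_rfl) (fun _ => by rw [τq, τp, h]; exact hxq))
  have hxq' : g x q tq = w x → SecondChoice (fun k => g x k (τ k)) r q := fun h =>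
    hsec hrq.symm (hall (fun _ => by rw [τs, τq, h]; exact hws x) (absurd rfl)
      (fun _ => by rw [τq, τp, h]; exact hxp) (fun _ => le_rfl))
  have hyq' : w y ≤ g y q tq → SecondChoice (fun k => g y k (τ k)) p q := fun h =>
    hsec hpq.symm (hall (fun _ => by rw [τs, τq]; exact (hws y).trans h)
      (fun _ => by rw [τr, τq]; exact (hwr y).trans h) (absurd rfl) (fun _ => le_rfl))
  have hzp' : w z ≤ g z p tp → SecondChoice (fun k => g z k (τ k)) q p := fun h =>
    hsec hpq (hall (fun _ => by rw [τs, τp]; exact (hws z).trans h)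
      (fun _ => by rw [τr, τp]; exact (hwr z).trans h) (fun _ => le_rfl) (absurd rfl))
  refine ⟨τ, hall (.inl τs) (.inl τr) (.inr (.inl τp)) (.inr (.inr τq)), ?_⟩
  refine exists_goodTrim hcx hcy hcz hxy hxz hyz hsr hsp hsq hrp hrq hpq hpref τs τr ?_ ?_ ?_ ?_ ?_
  · refine hall ?_ le_rfl ?_ ?_ <;> simp only [τs, τr, τp, τq, ← hwx]
    exacts [hws x, hxp, hxq]
  · refine hall ?_ ?_ le_rfl ?_ <;> simp only [τs, τr, τp, τq]
    exacts [(hws y).trans hyp, (hwr y).trans hyp, hyq]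
  · refine hall ?_ ?_ ?_ le_rfl <;> simp only [τs, τr, τp, τq]
    exacts [(hws z).trans hzq, (hwr z).trans hzq, hzp]
  · rw [τp, τq]
    exact hp.imp_right (Or.imp hxp' (And.imp hzp' (Or.imp hxq' (Or.imp_right hyq'))))
  · rw [τp, τq]
    exact hq.imp_right (Or.imp hxq' (And.imp hyq' (Or.imp hxp' (Or.imp_right hzp'))))

/-- Agent `y` is first in the contests for both pieces `p` and `q`, and prefers `p` to `q` if both
are trimmed as far as possible. She receives `p`. Piece `q` is not trimmed more than is necessary to
deter the agent `b₃` and to make `y` content with `p`. -/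
theorem exists_goodTrim_of_same_first {S : Set T} (hanti : ∀ i k, Antitone (g i k))
    {a₂ a₃ b₂ b₃ : Agent} {t₂ t₃ t₂' t₃' : T}
    (hcy : c ≠ y) (hca₂ : c ≠ a₂) (hya₂ : y ≠ a₂)
    (hcb₂ : c ≠ b₂) (hcb₃ : c ≠ b₃) (hyb₂ : y ≠ b₂) (hyb₃ : y ≠ b₃)
    (hb : b₂ ≠ b₃) (ha₂₃ : ∀ i, i ≠ c → i ≠ y → i = a₂ ∨ i = a₃)
    (hsr : s ≠ r) (hsp : s ≠ p) (hsq : s ≠ q) (hrp : r ≠ p) (hrq : r ≠ q) (hpq : p ≠ q)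
    (hpref : ¬ ∃ τ : Agent ≃ Fin 4, ∀ i, i ≠ c → ∀ k, g i k ⊥ ≤ g i (τ i) ⊥)
    {w : Agent → ℝ} (hw : ∀ i, w i = max (g i r ⊥) (g i s ⊥))
    (hp : IsRanked (g · p) w y a₂ a₃ t₂ t₃) (hq : IsRanked (g · q) w y b₂ b₃ t₂' t₃')
    (h0 : ⊥ ∈ S) (ht₂ : t₂ ∈ S) (ht₂' : t₂' ∈ S) (ht₃' : t₃' ∈ S)
    (hγ : ∃ γ ∈ S, IsTrimTo (g y q) (g y p t₂) γ) (hy : g y q t₂' ≤ g y p t₂) :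
    ∃ τ : Fin 4 → T, (∀ k, τ k ∈ S) ∧
      ∃ a, GoodTrim c (fun i k => g i k ⊥) (fun i k => g i k (τ k)) (fun k => τ k = ⊥) a := by
  obtain ⟨t, htS, h3t, ht2, hty, htcases⟩ : ∃ t ∈ S, t₃' ≤ t ∧ t ≤ t₂' ∧ g y q t ≤ g y p t₂ ∧
      (t = t₃' ∨ g y q t = g y p t₂) := by
    by_cases h3 : g y q t₃' ≤ g y p t₂
    · exact ⟨t₃', ht₃', le_rfl, hq.le, h3, .inl rfl⟩
    push Not at h3
    obtain ⟨γ, hγS, hγ⟩ := hγ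
    have hγ' := hγ.eq_of_le (h3.le.trans (hanti y q bot_le))
    rcases le_total γ t₂' with hle | hle
    · refine ⟨γ, hγS, ?_, hle, hγ'.le, .inr hγ'⟩
      by_contra! hlt
      exact (h3.trans_le (hanti y q hlt.le)).ne' hγ'
    · exact ⟨t₂', ht₂', hq.le, le_rfl, hy, .inr (le_antisymm hy (hγ' ▸ hanti y q hle))⟩
  have hle_p : ∀ i, i ≠ c → i ≠ y → g i p t₂ ≤ w i := by
    intro i hic hiy
    rcases ha₂₃ i hic hiy with rfl | rfl
    exacts [hp.second.le, (hanti _ p hp.le).trans hp.third]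
  have hb₂q : w b₂ ≤ g b₂ q t := hq.second ▸ hanti b₂ q ht2
  have hb₃q : g b₃ q t ≤ w b₃ := (hanti b₃ q h3t).trans hq.third
  have ha₂ : a₂ = b₂ ∨ a₂ = b₃ := by
    rcases eq_of_four hcy hcb₂ hcb₃ hyb₂ hyb₃ hb a₂ with h | h | h | h
    exacts [absurd h.symm hca₂, absurd h.symm hya₂, .inl h, .inr h]
  have hpa : g b₃ p t₂ = w b₃ ∨ w b₂ ≤ g b₂ p t₂ := by
    rcases ha₂ with rfl | rfl
    exacts [.inr hp.second.ge, .inl hp.second]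
  have hqa : t = ⊥ ∨ g b₃ q t = w b₃ ∨ w y ≤ g y q t := by
    rcases htcases with rfl | h
    · exact hq.third'.imp_right .inl
    · exact .inr (.inr (h ▸ hp.first))
  obtain ⟨τ, hτ, h⟩ := exists_goodTrim_of_two (x := b₃) (y := y) (z := b₂) hcb₃ hcy hcb₂ hyb₃.symm
    hb.symm hyb₂ hsr hsp hsq hrp hrq hpq hpref hw (tp := t₂) (tq := t) hp.first hty hb₂q
    ((hle_p b₂ hcb₂.symm hyb₂.symm).trans hb₂q) (hle_p b₃ hcb₃.symm hyb₃.symm) hb₃q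
    (by tauto) (by tauto)
  refine ⟨τ, fun k => ?_, h⟩
  rcases hτ k with h | h | h <;> rw [h] <;> assumption

/-- If the agents compete for the two pieces `p` and `q`, with `r` and `s` as alternatives, then
there is a good way to trim these two pieces. -/
theorem exists_goodTrim_of_contest {S : Set T} (hanti : ∀ i k, Antitone (g i k))
    {a₁ a₂ a₃ b₁ b₂ b₃ : Agent} {t₂ t₃ t₂' t₃' : T}
    (hca₁ : c ≠ a₁) (hca₂ : c ≠ a₂) (hca₃ : c ≠ a₃) (ha₁₂ : a₁ ≠ a₂) (ha₁₃ : a₁ ≠ a₃)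
    (ha₂₃ : a₂ ≠ a₃) (hcb₁ : c ≠ b₁) (hcb₂ : c ≠ b₂) (hcb₃ : c ≠ b₃) (hb₁₂ : b₁ ≠ b₂)
    (hb₁₃ : b₁ ≠ b₃) (hb₂₃ : b₂ ≠ b₃)
    (hsr : s ≠ r) (hsp : s ≠ p) (hsq : s ≠ q) (hrp : r ≠ p) (hrq : r ≠ q) (hpq : p ≠ q)
    (hpref : ¬ ∃ τ : Agent ≃ Fin 4, ∀ i, i ≠ c → ∀ k, g i k ⊥ ≤ g i (τ i) ⊥)
    {w : Agent → ℝ} (hw : ∀ i, w i = max (g i r ⊥) (g i s ⊥))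
    (hp : IsRanked (g · p) w a₁ a₂ a₃ t₂ t₃) (hq : IsRanked (g · q) w b₁ b₂ b₃ t₂' t₃')
    (h0 : ⊥ ∈ S) (ht₂ : t₂ ∈ S) (ht₃ : t₃ ∈ S) (ht₂' : t₂' ∈ S) (ht₃' : t₃' ∈ S)
    (hγ : ∀ i, ∃ γ ∈ S, IsTrimTo (g i q) (g i p t₂) γ)
    (hγ' : ∀ i, ∃ γ ∈ S, IsTrimTo (g i p) (g i q t₂') γ) :
    ∃ τ : Fin 4 → T, (∀ k, τ k ∈ S) ∧
      ∃ a, GoodTrim c (fun i k => g i k ⊥) (fun i k => g i k (τ k)) (fun k => τ k = ⊥) a := by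
  have ha := eq_of_four hca₁ hca₂ hca₃ ha₁₂ ha₁₃ ha₂₃
  have hb := eq_of_four hcb₁ hcb₂ hcb₃ hb₁₂ hb₁₃ hb₂₃
  have ha' : ∀ i, i ≠ c → i ≠ a₁ → i = a₂ ∨ i = a₃ := fun i h1 h2 => by
    rcases ha i with h | h | h
    exacts [absurd h h1, absurd h h2, h]
  have hb' : ∀ i, i ≠ c → i ≠ b₁ → i = b₂ ∨ i = b₃ := fun i h1 h2 => by
    rcases hb i with h | h | h
    exacts [absurd h h1, absurd h h2, h]
  by_cases hab : a₁ = b₁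
  · subst hab
    rcases le_total (g a₁ q t₂') (g a₁ p t₂) with hy | hy
    · exact exists_goodTrim_of_same_first hanti hca₁ hca₂ ha₁₂ hcb₂ hcb₃ hb₁₂ hb₁₃ hb₂₃ ha'
        hsr hsp hsq hrp hrq hpq hpref hw hp hq h0 ht₂ ht₂' ht₃' (hγ a₁) hy
    · exact exists_goodTrim_of_same_first hanti hca₁ hcb₂ hb₁₂ hca₂ hca₃ ha₁₂ ha₁₃ ha₂₃ hb'
        hsr hsq hsp hrq hrp hpq.symm hpref hw hq hp h0 ht₂' ht₂ ht₃ (hγ' a₁) hy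
  · obtain ⟨x, hxc, hxa, hxb⟩ := exists_fourth c a₁ b₁
    have hle_p : ∀ i, i ≠ c → i ≠ a₁ → g i p t₂ ≤ w i := by
      intro i hic hiy
      rcases ha' i hic hiy with rfl | rfl
      exacts [hp.second.le, (hanti _ p hp.le).trans hp.third]
    have hle_q : ∀ i, i ≠ c → i ≠ b₁ → g i q t₂' ≤ w i := by
      intro i hic hiy
      rcases hb' i hic hiy with rfl | rfl
      exacts [hq.second.le, (hanti _ q hq.le).trans hq.third]
    have hfour := eq_of_four hxc.symm hca₁ hcb₁ hxa hxb hab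
    have h1 : g x p t₂ = w x ∨ w b₁ ≤ g b₁ p t₂ := by
      rcases hfour a₂ with h | h | h | h
      exacts [absurd h.symm hca₂, .inl (h ▸ hp.second), absurd h.symm ha₁₂,
        .inr (h ▸ hp.second.ge)]
    have h2 : g x q t₂' = w x ∨ w a₁ ≤ g a₁ q t₂' := by
      rcases hfour b₂ with h | h | h | h
      exacts [absurd h.symm hcb₂, .inl (h ▸ hq.second), .inr (h ▸ hq.second.ge),
        absurd h.symm hb₁₂]
    obtain ⟨τ, hτ, h⟩ := exists_goodTrim_of_two hxc.symm hca₁ hcb₁ hxa hxb hab hsr hsp hsq hrp hrq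
      hpq hpref hw (tp := t₂) (tq := t₂') hp.first
      ((hle_q a₁ hca₁.symm hab).trans hp.first) hq.first
      ((hle_p b₁ hcb₁.symm (Ne.symm hab)).trans hq.first) (hle_p x hxc hxa) (hle_q x hxc hxb)
      (by tauto) (by tauto)
    refine ⟨τ, fun k => ?_, h⟩
    rcases hτ k with h | h | h <;> rw [h] <;> assumption

/-- Two steps of refinement of the set `{⊥}` of trims suffice: `S₁` has to contain the trims of
each piece to the value of another piece, and `S₂` those to the value of another piece that is
trimmed at a point of `S₁`. -/
theorem exists_goodTrim_of_grid {S₁ S₂ : Set T} (hanti : ∀ i k, Antitone (g i k)) (c : Agent)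
    (h0 : ⊥ ∈ S₁) (h12 : S₁ ⊆ S₂)
    (h1 : ∀ i k l, ∃ τ ∈ S₁, IsTrimTo (g i k) (g i l ⊥) τ)
    (h2 : ∀ i k l, ∀ σ ∈ S₁, ∃ τ ∈ S₂, IsTrimTo (g i k) (g i l σ) τ) :
    ∃ τ : Fin 4 → T, (∀ k, τ k ∈ S₂) ∧
      ∃ a, GoodTrim c (fun i k => g i k ⊥) (fun i k => g i k (τ k)) (fun k => τ k = ⊥) a := by
  by_cases hpref : ∃ τ : Agent ≃ Fin 4, ∀ i, i ≠ c → ∀ k, g i k ⊥ ≤ g i (τ i) ⊥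
  · obtain ⟨a, ha⟩ := hpref
    exact ⟨fun _ => ⊥, fun _ => h12 h0, a, rfl, ⟨c + 1, by simp, rfl⟩, ha, fun _ _ => rfl,
      fun _ h => absurd rfl h⟩
  -- Two agents share a favourite piece `p`.
  obtain ⟨i, j, p, hic, hjc, hij, hi, hj⟩ : ∃ i j p, i ≠ c ∧ j ≠ c ∧ i ≠ j ∧
      (∀ k, g i k ⊥ ≤ g i p ⊥) ∧ (∀ k, g j k ⊥ ≤ g j p ⊥) := by
    by_contra! hcon
    choose f _ hf using fun i => Finset.univ.exists_max_image (fun k => g i k ⊥)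
      Finset.univ_nonempty
    have hf' : ∀ i k, g i k ⊥ ≤ g i (f i) ⊥ := fun i k => hf i k (Finset.mem_univ k)
    have hinj : ∀ i j, i ≠ c → j ≠ c → i ≠ j → f i ≠ f j := fun i j hi hj hij h => by
      obtain ⟨k, hk⟩ := hcon i j (f i) hi hj hij (hf' i)
      exact hk.not_ge (h ▸ hf' j k)
    obtain ⟨x, hxc, -, -⟩ := exists_fourth c c c
    obtain ⟨y, hyc, hyx, -⟩ := exists_fourth c x x
    obtain ⟨z, hzc, hzx, hzy⟩ := exists_fourth c x y
    obtain ⟨s, hsx, hsy, hsz⟩ := exists_fourth (f x) (f y) (f z)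
    obtain ⟨e, -, hx, hy, hz⟩ := exists_assign hxc.symm hyc.symm hzc.symm hyx.symm hzx.symm
      hzy.symm hsx hsy hsz (hinj _ _ hxc hyc hyx.symm) (hinj _ _ hxc hzc hzx.symm)
      (hinj _ _ hyc hzc hzy.symm)
    refine hpref ⟨e, fun i hi k => ?_⟩
    rcases eq_of_four hxc.symm hyc.symm hzc.symm hyx.symm hzx.symm hzy.symm i with
      rfl | rfl | rfl | rfl
    exacts [absurd rfl hi, hx ▸ hf' _ k, hy ▸ hf' _ k, hz ▸ hf' _ k]
  -- First let the agents compete for `p` alone, with their best other pieces as alternatives.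
  choose l hlp hl using fun i => exists_secondChoice (fun k => g i k ⊥) p
  choose α hαS hα using fun i => h1 i p (l i)
  obtain ⟨a₁, a₂, a₃, hca₁, hca₂, hca₃, h12', h13, h23, hrank⟩ :=
    exists_isRanked (h := fun i => g i p) (w := fun i => g i (l i) ⊥)
      (fun i => hanti i p) hα hic hjc hij (hi _) (hj _)
  by_cases hl23 : l a₂ = l a₃
  · -- The two agents who do not receive `p` have the same alternative `q`.
    obtain ⟨r, hrp, hrq, -⟩ := exists_fourth p (l a₂) p
    obtain ⟨s, hsp, hsq, hsr⟩ := exists_fourth p (l a₂) r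
    have hmax : ∀ i k, ∃ τ ∈ S₁, IsTrimTo (g i k) (max (g i r ⊥) (g i s ⊥)) τ := by
      intro i k
      rcases max_choice (g i r ⊥) (g i s ⊥) with h | h <;> rw [h]
      exacts [h1 i k r, h1 i k s]
    choose α' hαS' hα' using fun i => hmax i p
    choose β hβS hβ using fun i => hmax i (l a₂)
    obtain ⟨b₁, b₂, b₃, hb1, hb2, hb3, hb4, hb5, hb6, hb⟩ :=
      exists_isRanked (h := fun i => g i p) (fun i => hanti i p) hα' hic hjc hij
        (max_le (hi r) (hi s)) (max_le (hj r) (hj s))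
    obtain ⟨d₁, d₂, d₃, hd1, hd2, hd3, hd4, hd5, hd6, hd⟩ :=
      exists_isRanked (h := fun i => g i (l a₂)) (fun i => hanti i (l a₂)) hβ hca₂.symm hca₃.symm
        h23 (max_le (hl a₂ r hrp) (hl a₂ s hsp))
        (hl23 ▸ max_le (hl a₃ r hrp) (hl a₃ s hsp))
    exact exists_goodTrim_of_contest hanti hb1 hb2 hb3 hb4 hb5 hb6 hd1 hd2 hd3 hd4 hd5 hd6
      hsr hsp hsq hrp hrq (hlp a₂).symm hpref (fun _ => rfl) hb hd (h12 h0) (h12 (hαS' _))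
      (h12 (hαS' _)) (h12 (hβS _)) (h12 (hβS _)) (fun i => h2 i _ _ _ (hαS' _))
      (fun i => h2 i _ _ _ (hβS _))
  · obtain ⟨s, hs2, hsp, hs3⟩ := exists_fourth (l a₂) p (l a₃)
    let τ : Fin 4 → T := fun k => if k = p then α a₂ else ⊥
    have τp : τ p = α a₂ := by simp [τ]
    have τne : ∀ k, k ≠ p → τ k = ⊥ := fun k hk => by simp [τ, hk]
    have hsecond := hrank.second
    have hfirst := hrank.first
    have hthird := (hanti a₃ p hrank.le).trans hrank.third
    refine ⟨τ, fun k => ?_, exists_goodTrim hca₂ hca₁ hca₃ h12'.symm h23 h13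
      hs2 hsp hs3 (hlp a₂) hl23 (hlp a₃).symm hpref (τne s hsp) (τne _ (hlp a₂)) ?_ ?_ ?_
      (.inr (.inl ⟨(hlp a₂).symm, fun k _ => ?_⟩)) (.inl (τne _ (hlp a₃)))⟩
    · by_cases hk : k = p
      · rw [hk, τp]; exact h12 (hαS _)
      · rw [τne k hk]; exact h12 h0
    · intro k
      rw [τne _ (hlp a₂)]
      by_cases hk : k = p
      · rw [hk, τp, hsecond]
      · rw [τne k hk]; exact hl a₂ k hk
    · intro k
      rw [τp]
      by_cases hk : k = p
      · rw [hk, τp]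
      · rw [τne k hk]; exact (hl a₁ k hk).trans hfirst
    · intro k
      rw [τne _ (hlp a₃)]
      by_cases hk : k = p
      · rw [hk, τp]; exact hthird
      · rw [τne k hk]; exact hl a₃ k hk
    · simp only [τp, hsecond]
      by_cases hk : k = p
      · rw [hk, τp, hsecond]
      · rw [τne k hk]; exact hl a₂ k hk

end contest

/-! ### The core protocol -/

section Core

open Set

/-- The number of queries that suffices for cutting a piece that consists of `m` intervals. -/
def cutBound (m : ℕ) : ℕ := (2 * m + 1) * m + 1

/-- Cut `R` into four consecutive parts that are worth the same to agent `c`. -/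
noncomputable def quarter (c : Agent) (R : Set Cake) : Protocol (Fin 4 → Set Cake) :=
  (evalPiece c R).bind fun v =>
  (cutPiece c R (v / 4)).bind fun t₁ =>
  (cutPiece c (trim R t₁) (v / 4)).bind fun t₂ =>
  (cutPiece c (trim (trim R t₁) t₂) (v / 4)).bind fun t₃ =>
  .ret ![R ∩ Iic t₁, trim R t₁ ∩ Iic t₂, trim (trim R t₁) t₂ ∩ Iic t₃,
    trim (trim (trim R t₁) t₂) t₃]

/-- The pieces `P k`, each consisting of at most `m` intervals, partition `R`, and have the same
value with respect to `v`. -/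
structure IsQuartering (v : Valuation) (m : ℕ) (R : Set Cake) (P : Fin 4 → Set Cake) : Prop where
  isPieceOf : ∀ k, IsPieceOf m (P k)
  disjoint : ∀ k l, k ≠ l → Disjoint (P k) (P l)
  iUnion_eq : ⋃ k, P k = R
  equal : ∀ k l, v.val (P k) = v.val (P l)

variable {V : Profile} {m : ℕ} {R : Set Cake}

theorem mem_trim_coe {P : Set Cake} {t x : Cake} : x ∈ trim P t ↔ x ∈ P ∧ t < x := by
  simp [trim]

theorem ensures_quarter (hR : IsPieceOf m R) (c : Agent) :
    Ensures V (m + (cutBound m + (cutBound m + (cutBound m + 0)))) (IsQuartering (V c) m R)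
      (quarter c R) := by
  have h0 := (V c).nonneg R hR.isPiece
  refine (ensures_evalPiece hR c).bind ?_
  rintro _ rfl
  refine (ensures_cutPiece hR c (by linarith) (by linarith)).bind fun t₁ ht₁ => ?_
  have hR₁ := hR.trim t₁
  have hv₁ := val_trim_coe (V c) hR.isPiece t₁
  refine (ensures_cutPiece hR₁ c (by linarith) (by linarith)).bind fun t₂ ht₂ => ?_
  have hR₂ := hR₁.trim t₂
  have hv₂ := val_trim_coe (V c) hR₁.isPiece t₂
  refine (ensures_cutPiece hR₂ c (by linarith) (by linarith)).bind fun t₃ ht₃ => .ret ?_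
  have hv₃ := val_trim_coe (V c) hR₂.isPiece t₃
  have hval : ∀ k, (V c).val (![R ∩ Iic t₁, trim R t₁ ∩ Iic t₂, trim (trim R t₁) t₂ ∩ Iic t₃,
      trim (trim (trim R t₁) t₂) t₃] k) = (V c).val R / 4 := by
    intro k
    fin_cases k
    · exact ht₁
    · exact ht₂
    · exact ht₃
    · exact hv₃.trans (by linarith)
  refine ⟨fun k => ?_, fun k l hkl => ?_, ?_, fun k l => (hval k).trans (hval l).symm⟩
  · fin_cases k
    exacts [hR.inter_ordConnected ordConnected_Iic, hR₁.inter_ordConnected ordConnected_Iic,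
      hR₂.inter_ordConnected ordConnected_Iic, hR₂.trim t₃]
  · wlog hlt : k < l generalizing k l
    · exact (this l k hkl.symm (lt_of_le_of_ne (not_lt.1 hlt) hkl.symm)).symm
    refine disjoint_left.2 fun x hx hx' => ?_
    fin_cases k <;> fin_cases l <;> simp [mem_trim_coe] at hx hx' hlt <;> grind
  · ext x
    simp only [mem_iUnion, Fin.exists_fin_succ, Matrix.cons_val_zero, Matrix.cons_val_succ,
      IsEmpty.exists_iff, mem_inter_iff, mem_Iic, mem_trim_coe, or_false]
    have h₁ := le_or_gt x t₁
    have h₂ := le_or_gt x t₂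
    have h₃ := le_or_gt x t₃
    tauto

/-- Indices for a set of trims (with indices in `I`) together with all trims that an agent makes to
a piece in order to give it the value that another piece has when trimmed at a point of that
set: `(i, k, l, x)` stands for the trim of piece `k` by agent `i` to the value of piece `l` trimmed
at the point number `x`. -/
abbrev Grid (I : Type) : Type := I ⊕ (Agent × Fin 4 × Fin 4 × I)

/-- Extend a set of trims as described at `Grid`. -/
noncomputable def refineTrims {I : Type} [Fintype I] (P : Fin 4 → Set Cake) (pt : I → WithBot Cake) :
    Protocol (Grid I → WithBot Cake) :=
  (table fun y : Agent × Fin 4 × I => evalPiece y.1 (trim (P y.2.1) (pt y.2.2))).bind fun val =>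
  (table fun y : Agent × Fin 4 × Fin 4 × I =>
    trimTo y.1 (P y.2.1) (val (y.1, y.2.2.1, y.2.2.2))).bind fun new =>
  .ret (Sum.elim pt new)

/-- The number of queries that suffices for `refineTrims` if the pieces consist of `m` intervals
each. -/
def refineBound (I : Type) [Fintype I] (m : ℕ) : ℕ :=
  Fintype.card (Agent × Fin 4 × I) * m +
    (Fintype.card (Agent × Fin 4 × Fin 4 × I) * (m + cutBound m) + 0)

theorem ensures_refineTrims {I : Type} [Fintype I] {P : Fin 4 → Set Cake}
    (hP : ∀ k, IsPieceOf m (P k)) (pt : I → WithBot Cake) :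
    Ensures V (refineBound I m) (fun pt' => (∀ x, pt' (.inl x) = pt x) ∧
      ∀ i k l x, IsTrimTo (fun σ => (V i).val (trim (P k) σ)) ((V i).val (trim (P l) (pt x)))
        (pt' (.inr (i, k, l, x)))) (refineTrims P pt) := by
  refine (Ensures.table fun y : Agent × Fin 4 × I =>
    ensures_evalPiece ((hP y.2.1).trim (pt y.2.2)) y.1).bind fun val hval => ?_
  refine (Ensures.table fun y : Agent × Fin 4 × Fin 4 × I => ensures_trimTo (hP y.2.1) y.1
    (r := val (y.1, y.2.2.1, y.2.2.2)) ?_).bind fun new hnew => .ret ⟨fun _ => rfl, ?_⟩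
  · rw [hval]
    exact (V y.1).nonneg _ ((hP _).trim _).isPiece
  · intro i k l x
    have := hnew (i, k, l, x)
    rwa [hval] at this

open Classical in
/-- The core protocol: agent `c` cuts the cake into quarters, two rounds of trims are collected, and
all agents evaluate all pieces with all these trims. From these data a good way to trim and assign
the pieces is selected. -/
noncomputable def coreProtocol (c : Agent) (R : Set Cake) : Protocol CoreOutcome :=
  (quarter c R).bind fun P =>
  (refineTrims P fun _ : Unit => ⊥).bind fun pt₁ =>
  (refineTrims P pt₁).bind fun pt =>
  (table fun y : Agent × Fin 4 × Grid (Grid Unit) =>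
    evalPiece y.1 (trim (P y.2.1) (pt y.2.2))).bind fun val =>
  if h : ∃ xa : (Fin 4 → Grid (Grid Unit)) × (Agent ≃ Fin 4),
      GoodTrim c (fun i k => val (i, k, .inl (.inl ()))) (fun i k => val (i, k, xa.1 k))
        (fun k => pt (xa.1 k) = ⊥) xa.2 then
    .ret { piece := P, part := fun k => trim (P k) (pt (h.choose.1 k)), assign := h.choose.2 }
  else .ret { piece := P, part := P, assign := Equiv.refl _ }

/-- The number of queries that suffices for the core protocol on a cake of `m` intervals. -/
def coreBound (m : ℕ) : ℕ :=
  m + (cutBound m + (cutBound m + (cutBound m + 0))) + (refineBound Unit m +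
    (refineBound (Grid Unit) m + (Fintype.card (Agent × Fin 4 × Grid (Grid Unit)) * m + 0)))

/-- What the core protocol achieves on a cake `R` of `m` intervals, beyond the requirements of
`IsCoreOutcome`: the outcome is composed of few intervals, and the holder of a trimmed piece can be
made to give it away as in `GoodTrim`. -/
structure IsSwappableOutcome (V : Profile) (c : Agent) (m : ℕ) (R : Set Cake) (o : CoreOutcome) :
    Prop extends IsCoreOutcome V c R o where
  isPieceOf_part : ∀ k, IsPieceOf m (o.part k)
  isPieceOf_diff : ∀ k, IsPieceOf m (o.piece k \ o.part k)
  swap : ∀ k, ¬ o.Complete k → ∃ σ : Agent ≃ Fin 4, o.Complete (σ c) ∧ σ (o.assign.symm k) ≠ k ∧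
    ∀ i, i ≠ c → ∀ l, l ≠ o.assign i → (V i).val (o.part l) ≤ (V i).val (o.part (σ i))

theorem IsSwappableOutcome.isPieceOf_residue {c : Agent} {o : CoreOutcome}
    (h : IsSwappableOutcome V c m R o) : IsPieceOf (4 * m) o.residue :=
  IsPieceOf.iUnion_fin h.isPieceOf_diff

theorem ensures_coreProtocol (hR : IsPieceOf m R) (c : Agent) :
    Ensures V (coreBound m) (IsSwappableOutcome V c m R) (coreProtocol c R) := by
  refine (ensures_quarter hR c).bind fun P hP => ?_
  refine (ensures_refineTrims hP.isPieceOf _).bind fun pt₁ ⟨hpt₁, htrim₁⟩ => ?_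
  refine (ensures_refineTrims hP.isPieceOf _).bind fun pt ⟨hpt, htrim⟩ => ?_
  refine (Ensures.table fun y : Agent × Fin 4 × Grid (Grid Unit) =>
    ensures_evalPiece ((hP.isPieceOf y.2.1).trim (pt y.2.2)) y.1).bind fun val hval => ?_
  have hPp : ∀ k, IsPiece (P k) := fun k => (hP.isPieceOf k).isPiece
  have hval' : ∀ i k x, val (i, k, x) = (V i).val (trim (P k) (pt x)) := fun i k x => hval _
  have hbot : pt (.inl (.inl ())) = ⊥ := by rw [hpt, hpt₁]
  have hgood : ∃ xa : (Fin 4 → Grid (Grid Unit)) × (Agent ≃ Fin 4),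
      GoodTrim c (fun i k => val (i, k, .inl (.inl ()))) (fun i k => val (i, k, xa.1 k))
        (fun k => pt (xa.1 k) = ⊥) xa.2 := by
    obtain ⟨τ, hτ, a, ha⟩ := exists_goodTrim_of_grid (S₁ := range pt₁) (S₂ := range pt)
      (g := fun i k τ => (V i).val (trim (P k) τ))
      (fun i k σ τ h => (V i).val_mono ((hPp k).trim σ) ((hPp k).trim τ) (trim_anti _ h)) c
      ⟨_, hpt₁ ()⟩ (by rintro _ ⟨x, rfl⟩; exact ⟨_, hpt x⟩)
      (fun i k l => ⟨_, ⟨_, rfl⟩, htrim₁ i k l ()⟩)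
      (by rintro i k l _ ⟨x, rfl⟩; exact ⟨_, ⟨_, rfl⟩, htrim i k l x⟩)
    choose x hx using hτ
    refine ⟨(x, a), ?_⟩
    simp only [hval', hbot, hx]
    exact ha
  rw [dif_pos hgood]
  obtain ⟨hcut, hother, hef, hpref, hswap⟩ := hgood.choose_spec
  set x := hgood.choose.1
  set a := hgood.choose.2
  simp only [hval', hbot, trim_bot] at hef hpref hswap
  have hcomplete : ∀ k, pt (x k) = ⊥ → trim (P k) (pt (x k)) = P k := fun k h => by
    rw [h, trim_bot]
  refine .ret ⟨⟨hPp, hP.disjoint, hP.iUnion_eq, hP.equal, fun k => (hPp k).trim _,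
    fun k => trim_subset _ _, fun k y hy z hz hyz => ⟨hz, hy.2.trans_le (WithBot.coe_le_coe.2 hyz)⟩,
    hcomplete _ hcut, ?_, ?_, fun h k => hcomplete k (hpref h k)⟩, fun k => (hP.isPieceOf k).trim _,
    fun k => (hP.isPieceOf k).diff_trim _, fun k hk => ?_⟩
  · obtain ⟨i, hi, h⟩ := hother
    exact ⟨i, hi, hcomplete _ h⟩
  · intro i j
    by_cases hi : i = c
    · subst hi
      simp only [hcomplete _ hcut]
      rw [hP.equal (a i) (a j)]
      exact (V i).val_mono (hPp _) ((hPp _).trim _) (trim_subset _ _)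
    · exact hef i hi (a j)
  · obtain ⟨σ, h1, h2, h3⟩ := hswap k fun h => hk (hcomplete k h)
    exact ⟨σ, hcomplete _ h1, h2, h3⟩

end Core

/-! ### Reallocating one of four runs -/

section FourRuns

open Set

section realloc

variable {V : Profile} {c j : Agent}

/-- If agent `j` is the only agent other than the cutter with a significant piece, then something
of value to the cutter has been trimmed off that piece, as otherwise all pieces would be
significant. -/
theorem IsCoreOutcome.not_complete_of_significant_iff {R : Set Cake} {o : CoreOutcome}
    (ho : IsCoreOutcome V c R o)
    (hsame : ∀ i, i ≠ c → (o.Significant (V c) (o.assign i) ↔ i = j)) (hj : j ≠ c) :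
    ¬ o.Complete (o.assign j) := by
  intro hcomp
  obtain ⟨i, hic, hij, -⟩ := exists_fourth c j j
  refine hij ((hsame i hic).1 fun l => ?_)
  have h := (hsame j hj).2 rfl l
  rw [show o.part (o.assign j) = _ from hcomp, sdiff_self,
    (V c).val_empty] at h
  exact h.trans ((V c).nonneg _ ((ho.isPiece _).diff (ho.isPiece_part _)))

/-- The margin of an agent in a run is the amount by which she prefers her piece to her second
choice. As there are only three agents besides the cutter, one of four runs is such that no agent
has her strictly largest margin in that run. In that run the swap of `IsSwappableOutcome` is carried
out: an agent who has to be content with a second choice can only envy the agent who has taken over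
her former piece, and only by her margin in that run, which is made good in another run. -/
theorem exists_reassignment {o : Fin 4 → CoreOutcome} {M : Fin 4 → ℕ} {R : Fin 4 → Set Cake}
    (ho : ∀ t, IsSwappableOutcome V c (M t) (R t) (o t)) (hj : j ≠ c)
    (hsame : ∀ t i, i ≠ c → ((o t).Significant (V c) ((o t).assign i) ↔ i = j)) :
    ∃ (s : Fin 4) (σ : Agent ≃ Fin 4), (o s).Complete (σ c) ∧
      (∃ i, i ≠ c ∧ i ≠ j ∧ (o s).Significant (V c) (σ i)) ∧
      ∀ i k, ∑ t, (V i).val ((o t).part (Function.update (fun t => (o t).assign) s σ t k)) ≤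
        ∑ t, (V i).val ((o t).part (Function.update (fun t => (o t).assign) s σ t i)) := by
  have hnc : ∀ t, ¬ (o t).Complete ((o t).assign j) := fun t =>
    (ho t).not_complete_of_significant_iff (hsame t) hj
  choose σ hσc hσj hσ using fun t => (ho t).swap _ (hnc t)
  simp only [Equiv.symm_apply_apply] at hσj
  choose κ hκne hκ using fun (i : Agent) (t : Fin 4) =>
    exists_secondChoice (fun l => (V i).val ((o t).part l)) ((o t).assign i)
  let μ : Agent → Fin 4 → ℝ := fun i t =>
    (V i).val ((o t).part ((o t).assign i)) - (V i).val ((o t).part (κ i t))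
  obtain ⟨s, hs⟩ : ∃ s, ∀ i, i ≠ c → ∃ t, t ≠ s ∧ μ i s ≤ μ i t := by
    by_contra! hcon
    choose f hfc hf using hcon
    have hinj : Function.Injective f := by
      intro s t hst
      by_contra hne
      have h1 := hf s t (Ne.symm hne)
      have h2 := hf t s hne
      rw [hst] at h1
      exact lt_asymm h1 h2
    obtain ⟨s, hs⟩ := Finite.injective_iff_surjective.1 hinj c
    exact hfc s hs
  refine ⟨s, σ s, hσc s, ⟨(σ s).symm ((o s).assign j), ?_, ?_, ?_⟩, fun i k => ?_⟩
  · intro h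
    rw [Equiv.symm_apply_eq] at h
    exact hnc s (h ▸ hσc s)
  · intro h
    rw [Equiv.symm_apply_eq] at h
    exact hσj s h.symm
  · rw [Equiv.apply_symm_apply]
    exact (hsame s j hj).2 rfl
  · set H := Function.update (fun t => (o t).assign) s (σ s) with hH
    have hHs : H s = σ s := Function.update_self ..
    have hHt : ∀ t, t ≠ s → H t = (o t).assign := fun t ht => Function.update_of_ne ht ..
    by_cases hic : i = c
    · subst hic
      refine Finset.sum_le_sum fun t _ => ?_
      have hcomp : (o t).Complete (H t i) := by
        by_cases ht : t = s
        · subst ht; rw [hHs]; exact hσc t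
        · rw [hHt t ht]; exact (ho t).complete_cutter
      rw [show (o t).part (H t i) = _ from hcomp, (ho t).equal (H t i) (H t k)]
      exact (V i).val_mono ((ho t).isPiece _) ((ho t).isPiece_part _) ((ho t).part_subset _)
    · rw [← sub_nonneg, ← Finset.sum_sub_distrib]
      set D : Fin 4 → ℝ := fun t => (V i).val ((o t).part (H t i)) - (V i).val ((o t).part (H t k))
        with hD
      have hDt : ∀ t, t ≠ s → 0 ≤ D t := fun t ht => by
        simp only [hD, hHt t ht]
        exact sub_nonneg.2 ((ho t).envyFree i k)
      rw [← Finset.add_sum_erase _ D (Finset.mem_univ s)]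
      have hrest : ∀ t, t ≠ s → D t ≤ ∑ t ∈ Finset.univ.erase s, D t := fun t ht =>
        Finset.single_le_sum (fun t ht => hDt t (Finset.ne_of_mem_erase ht)) (by simpa using ht)
      obtain ⟨t, hts, hμ⟩ := hs i hic
      refine le_trans ?_ (add_le_add_right (hrest t hts) (D s))
      by_cases hki : k = i
      · subst hki; simp [hD]
      by_cases hold : σ s k = (o s).assign i
      · have h1 := hσ s i hic _ (hκne i s)
        have h2 := hκ i t ((o t).assign k) fun h => hki ((o t).assign.injective h)
        simp only [hD, hHs, hHt t hts, hold]
        simp only [μ] at hμ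
        linarith
      · have h1 := hσ s i hic _ hold
        have h2 := hDt t hts
        simp only [hD, hHs] at h2 ⊢
        linarith

/-- Run `s` can be reassigned according to `σ`, given the values `d` to the cutter of what has been
trimmed off the pieces of each run, and the values `u` of the parts to all agents: agent `j` is the
only agent besides the cutter with significant pieces in all runs, and the reassignment remedies
this without causing envy. -/
structure IsReassignment (c : Agent) (o : Fin 4 → CoreOutcome) (d : Fin 4 × Fin 4 → ℝ)
    (u : Fin 4 × Agent × Fin 4 → ℝ) (j : Agent) (s : Fin 4) (σ : Agent ≃ Fin 4) : Prop where
  ne : j ≠ c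
  same : ∀ t i, i ≠ c → ((∀ l, d (t, l) ≤ d (t, (o t).assign i)) ↔ i = j)
  complete : (o s).Complete (σ c)
  significant : ∃ i, i ≠ c ∧ i ≠ j ∧ ∀ l, d (s, l) ≤ d (s, σ i)
  envyFree : ∀ i k, ∑ t, u (t, i, Function.update (fun t => (o t).assign) s σ t k) ≤
    ∑ t, u (t, i, Function.update (fun t => (o t).assign) s σ t i)

open Classical in
/-- Evaluate everything that matters for `IsReassignment`, and reassign one of the four runs if
possible. -/
noncomputable def reallocate (c : Agent) (o : Fin 4 → CoreOutcome) :
    Protocol (Fin 4 → Agent ≃ Fin 4) :=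
  (table fun y : Fin 4 × Fin 4 =>
    evalPiece c ((o y.1).piece y.2 \ (o y.1).part y.2)).bind fun d =>
  (table fun y : Fin 4 × Agent × Fin 4 => evalPiece y.2.1 ((o y.1).part y.2.2)).bind fun u =>
  if h : ∃ x : Agent × Fin 4 × (Agent ≃ Fin 4), IsReassignment c o d u x.1 x.2.1 x.2.2 then
    .ret (Function.update (fun t => (o t).assign) h.choose.2.1 h.choose.2.2)
  else .ret fun t => (o t).assign

/-- The values to the cutter of what has been trimmed off. -/
def trimmedValue (v : Valuation) (o : Fin 4 → CoreOutcome) (y : Fin 4 × Fin 4) : ℝ :=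
  v.val ((o y.1).piece y.2 \ (o y.1).part y.2)

/-- The values of the parts to all agents. -/
def partValue (V : Profile) (o : Fin 4 → CoreOutcome) (y : Fin 4 × Agent × Fin 4) : ℝ :=
  (V y.2.1).val ((o y.1).part y.2.2)

/-- The number of queries that suffices for `reallocate` if all parts consist of at most `m`
intervals. -/
def reallocBound (m : ℕ) : ℕ :=
  Fintype.card (Fin 4 × Fin 4) * m + (Fintype.card (Fin 4 × Agent × Fin 4) * m + 0)

theorem ensures_reallocate {o : Fin 4 → CoreOutcome} {m : ℕ} {M : Fin 4 → ℕ}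
    {R : Fin 4 → Set Cake} (ho : ∀ t, IsSwappableOutcome V c (M t) (R t) (o t))
    (hM : ∀ t, M t ≤ m) :
    Ensures V (reallocBound m) (fun H =>
      (∃ j s σ, IsReassignment c o (trimmedValue (V c) o) (partValue V o) j s σ ∧
        H = Function.update (fun t => (o t).assign) s σ) ∨
      ((¬ ∃ j, j ≠ c ∧ ∀ t i, i ≠ c → ((o t).Significant (V c) ((o t).assign i) ↔ i = j)) ∧
        H = fun t => (o t).assign)) (reallocate c o) := by
  refine (Ensures.table fun y : Fin 4 × Fin 4 =>
    ensures_evalPiece (((ho y.1).isPieceOf_diff y.2).mono (hM _)) c).bind fun d hd => ?_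
  refine (Ensures.table fun y : Fin 4 × Agent × Fin 4 =>
    ensures_evalPiece (((ho y.1).isPieceOf_part y.2.2).mono (hM _)) y.2.1).bind fun u hu => ?_
  obtain rfl : d = trimmedValue (V c) o := funext hd
  obtain rfl : u = partValue V o := funext hu
  split_ifs with h
  · exact .ret (.inl ⟨_, _, _, h.choose_spec, rfl⟩)
  · refine .ret (.inr ⟨fun ⟨j, hj, hsame⟩ => h ?_, rfl⟩)
    obtain ⟨s, σ, h1, h2, h3⟩ := exists_reassignment ho hj hsame
    exact ⟨(j, s, σ), hj, hsame, h1, h2, h3⟩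

end realloc

/-! ### Domination -/

section domination

variable {V : Profile} {c : Agent}

theorem sum_le_two_mul {f : Fin 4 → ℝ} {a b : Fin 4} {M : ℝ} (hab : a ≠ b) (ha : f a = 0)
    (hb : f b = 0) (hf : ∀ k, f k ≤ M) : ∑ k, f k ≤ 2 * M := by
  have h0 := hf 0
  have h1 := hf 1
  have h2 := hf 2
  have h3 := hf 3
  rw [Fin.sum_univ_four]
  fin_cases a <;> fin_cases b <;> simp at ha hb hab <;> linarith

namespace IsCoreOutcome

variable {R : Set Cake} {o : CoreOutcome} (h : IsCoreOutcome V c R o)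

include h

theorem isPiece_diff (k : Fin 4) : IsPiece (o.piece k \ o.part k) :=
  (h.isPiece k).diff (h.isPiece_part k)

theorem isPiece_residue : IsPiece o.residue := IsPiece.iUnion_fin h.isPiece_diff

theorem piece_subset (k : Fin 4) : o.piece k ⊆ R := h.iUnion_piece ▸ subset_iUnion o.piece k

theorem residue_subset : o.residue ⊆ R :=
  iUnion_subset fun k => sdiff_subset.trans (h.piece_subset k)

theorem disjoint_part_residue (k : Fin 4) : Disjoint (o.part k) o.residue := by
  refine disjoint_iUnion_right.2 fun l => ?_
  by_cases hkl : k = l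
  · subst hkl; exact disjoint_sdiff_right
  · exact (h.disjoint k l hkl).mono (h.part_subset k) sdiff_subset

theorem mem_residue_iff {x : Cake} : x ∈ o.residue ↔ x ∈ R ∧ ∀ k, x ∉ o.part k := by
  constructor
  · intro hx
    exact ⟨h.residue_subset hx, fun k hk => disjoint_left.1 (h.disjoint_part_residue k) hk hx⟩
  · rintro ⟨hx, hk⟩
    rw [← h.iUnion_piece] at hx
    obtain ⟨k, hxk⟩ := mem_iUnion.1 hx
    exact mem_iUnion.2 ⟨k, hxk, hk k⟩

theorem val_residue (v : Valuation) :
    v.val o.residue = ∑ k, v.val (o.piece k \ o.part k) :=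
  v.val_iUnion_fin h.isPiece_diff fun k l hkl =>
    (h.disjoint k l hkl).mono sdiff_subset sdiff_subset

/-- The residue comes from at most two of the pieces. -/
theorem val_residue_le {M : ℝ} (hM : ∀ k, (V c).val (o.piece k \ o.part k) ≤ M) :
    (V c).val o.residue ≤ 2 * M := by
  have hzero : ∀ k, o.Complete k → (V c).val (o.piece k \ o.part k) = 0 := fun k hk => by
    rw [show o.part k = _ from hk, sdiff_self, (V c).val_empty]
  obtain ⟨i, hi, hic⟩ := h.complete_other
  rw [h.val_residue]
  exact sum_le_two_mul (fun h => hi (o.assign.injective h).symm) (hzero _ h.complete_cutter)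
    (hzero _ hic) hM

theorem two_mul_val_residue_le : 2 * (V c).val o.residue ≤ (V c).val R := by
  have h1 : (V c).val R = 4 * (V c).val (o.piece 0) := by
    rw [← h.iUnion_piece, (V c).val_iUnion_fin h.isPiece h.disjoint,
      Finset.sum_congr rfl fun k _ => h.equal k 0]
    simp
  have h2 := h.val_residue_le (M := (V c).val (o.piece 0)) fun k => by
    rw [h.equal 0 k]
    exact (V c).val_mono (h.isPiece k) (h.isPiece_diff k) sdiff_subset
  linarith

/-- Some agent other than the cutter gets a significant piece. -/
theorem exists_significant : ∃ i, i ≠ c ∧ o.Significant (V c) (o.assign i) := by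
  obtain ⟨k, -, hk⟩ := Finset.univ.exists_max_image
    (fun k => (V c).val (o.piece k \ o.part k)) Finset.univ_nonempty
  by_cases hkc : o.assign.symm k = c
  · obtain ⟨i, hi, -⟩ := h.complete_other
    refine ⟨i, hi, fun l => (hk l (Finset.mem_univ l)).trans ?_⟩
    rw [Equiv.symm_apply_eq] at hkc
    subst hkc
    rw [show o.part _ = _ from h.complete_cutter, sdiff_self, (V c).val_empty]
    exact (V c).nonneg _ (h.isPiece_diff _)
  · refine ⟨_, hkc, fun l => ?_⟩
    rw [Equiv.apply_symm_apply]
    exact hk l (Finset.mem_univ l)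

end IsCoreOutcome

/-- Five consecutive runs of a core protocol, on the cakes `C t`, with arbitrary reassignments. -/
structure IsRunSequence (V : Profile) (c : Agent) (C : Fin 5 → Set Cake) (o : Outcome) : Prop where
  core : ∀ t, IsCoreOutcome V c (C t) (o.run t)
  succ : ∀ t : Fin 4, C t.succ = (o.run t.castSucc).residue

namespace IsRunSequence

variable {C : Fin 5 → Set Cake} {o : Outcome} (h : IsRunSequence V c C o)

include h

theorem antitone : Antitone C :=
  Fin.antitone_iff_succ_le.2 fun t => h.succ t ▸ (h.core t.castSucc).residue_subset

theorem disjoint_part_of_lt {s t : Fin 5} (hst : s < t) (k l : Fin 4) :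
    Disjoint ((o.run s).part k) ((o.run t).part l) := by
  obtain ⟨s, rfl⟩ := Fin.exists_castSucc_eq.2 (hst.trans_le (Fin.le_last t)).ne
  refine ((h.core s.castSucc).disjoint_part_residue k).mono_right ?_
  rw [← h.succ]
  exact ((h.core t).part_subset l).trans (((h.core t).piece_subset l).trans
    (h.antitone (Fin.castSucc_lt_iff_succ_le.1 hst)))

theorem disjoint_part {s t : Fin 5} {k l : Fin 4} (hst : s ≠ t ∨ k ≠ l) :
    Disjoint ((o.run s).part k) ((o.run t).part l) := by
  rcases lt_trichotomy s t with hlt | rfl | hlt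
  · exact h.disjoint_part_of_lt hlt k l
  · exact ((h.core s).disjoint k l (hst.resolve_left (absurd rfl))).mono
      ((h.core s).part_subset k) ((h.core s).part_subset l)
  · exact (h.disjoint_part_of_lt hlt l k).symm

theorem isPiece_share (i : Agent) : IsPiece (o.share i) :=
  IsPiece.iUnion_fin fun t => (h.core t).isPiece_part _

theorem isPartialAllocation : IsPartialAllocation (C 0) o.share := by
  refine ⟨fun i => ⟨h.isPiece_share i, iUnion_subset fun t => ?_⟩, fun i j hij => ?_⟩
  · exact ((h.core t).part_subset _).trans (((h.core t).piece_subset _).trans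
      (h.antitone (Fin.zero_le t)))
  · refine disjoint_iUnion_left.2 fun s => disjoint_iUnion_right.2 fun t => h.disjoint_part ?_
    by_cases hst : s = t
    · subst hst
      exact .inr fun heq => hij ((o.holder s).injective heq)
    · exact .inl hst

theorem val_share (v : Valuation) (i : Agent) :
    v.val (o.share i) = ∑ t, v.val ((o.run t).part (o.holder t i)) :=
  v.val_iUnion_fin (fun t => (h.core t).isPiece_part _) fun _ _ hst => h.disjoint_part (.inl hst)

theorem diff_iUnion_share : C 0 \ ⋃ i, o.share i = (o.run (Fin.last 4)).residue := by
  have hmem : ∀ x, x ∈ ⋃ i, o.share i ↔ ∃ t k, x ∈ (o.run t).part k := by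
    intro x
    simp only [Outcome.share, mem_iUnion]
    constructor
    · rintro ⟨i, t, hx⟩
      exact ⟨t, _, hx⟩
    · rintro ⟨t, k, hx⟩
      exact ⟨(o.holder t).symm k, t, by simpa using hx⟩
  ext x
  rw [Set.mem_sdiff, hmem]
  push Not
  constructor
  · rintro ⟨hx0, hx⟩
    have hC : ∀ t, x ∈ C t := by
      intro t
      induction t using Fin.induction with
      | zero => exact hx0
      | succ t ih => rw [h.succ, (h.core _).mem_residue_iff]; exact ⟨ih, hx _⟩
    exact (h.core _).mem_residue_iff.2 ⟨hC _, hx _⟩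
  · intro hx
    refine ⟨h.antitone (Fin.zero_le _) ((h.core _).residue_subset hx), fun t k hk => ?_⟩
    have hres : x ∈ (o.run t).residue := by
      rcases (Fin.le_last t).eq_or_lt with rfl | hlt
      · exact hx
      · obtain ⟨s, rfl⟩ := Fin.exists_castSucc_eq.2 hlt.ne
        rw [← h.succ]
        exact h.antitone (Fin.castSucc_lt_iff_succ_le.1 hlt) ((h.core _).residue_subset hx)
    exact disjoint_left.1 ((h.core t).disjoint_part_residue k) hk hres

theorem val_residue_last_le (s : Fin 4) :
    2 * (V c).val (o.run (Fin.last 4)).residue ≤ (V c).val (o.run s.castSucc).residue := by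
  have hhalf : ∀ t : Fin 4, 2 * (V c).val (o.run t.succ).residue ≤
      (V c).val (o.run t.castSucc).residue := fun t => by
    rw [← h.succ]; exact (h.core t.succ).two_mul_val_residue_le
  have hpos : ∀ t, 0 ≤ (V c).val (o.run t).residue := fun t =>
    (V c).nonneg _ (h.core t).isPiece_residue
  have hlast : (V c).val (o.run (Fin.last 4)).residue ≤ (V c).val (o.run s.succ).residue := by
    have hanti : Antitone fun t => (V c).val (o.run t).residue :=
      Fin.antitone_iff_succ_le.2 fun t => by linarith [hhalf t, hpos t.succ]
    exact hanti (Fin.le_last _)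
  linarith [hhalf s]

/-- A significant piece in one of the first four runs suffices for domination: to the cutter, what
has been trimmed off it is worth at least half of the residue of that run, and hence at least the
final residue. -/
theorem dominates (hc : ∀ t, (o.run t).Complete (o.holder t c)) {i : Agent} {s : Fin 4}
    (hsig : (o.run s.castSucc).Significant (V c) (o.holder s.castSucc i)) :
    Dominates V (C 0) o.share c i := by
  set d : Fin 5 → ℝ := fun t =>
    (V c).val ((o.run t).piece (o.holder t i) \ (o.run t).part (o.holder t i)) with hd
  have hd0 : ∀ t, 0 ≤ d t := fun t => (V c).nonneg _ ((h.core t).isPiece_diff _)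
  have hdiff : ∀ t, (V c).val ((o.run t).part (o.holder t c)) =
      (V c).val ((o.run t).part (o.holder t i)) + d t := fun t => by
    rw [show (o.run t).part (o.holder t c) = _ from hc t, (h.core t).equal _ (o.holder t i),
      ← (V c).val_diff_add ((h.core t).isPiece _) ((h.core t).isPiece_part (o.holder t i))
        ((h.core t).part_subset _), add_comm]
  have h1 := (h.core s.castSucc).val_residue_le hsig
  have h2 := h.val_residue_last_le s
  have h3 : d s.castSucc ≤ ∑ t, d t :=
    Finset.single_le_sum (fun t _ => hd0 t) (Finset.mem_univ s.castSucc)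
  rw [Dominates, h.diff_iUnion_share, (V c).additive _ _ (h.isPiece_share i)
    (h.core _).isPiece_residue, h.val_share, h.val_share, Finset.sum_congr rfl fun t _ => hdiff t,
    Finset.sum_add_distrib]
  · linarith
  · rw [← h.diff_iUnion_share]
    exact disjoint_sdiff_right.mono_left (subset_iUnion o.share i)

end IsRunSequence

end domination

end FourRuns

/-! ### The permutation protocol -/

section FiveRuns

open Set

section permutation

variable {V : Profile} {c : Agent} {C : Fin 5 → Set Cake} {o : Outcome}

theorem sameAgent_iff {j : Agent} : o.SameAgent V c j ↔ j ≠ c ∧ ∀ (t : Fin 4) (i : Agent), i ≠ c →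
    ((o.run t.castSucc).Significant (V c) ((o.run t.castSucc).assign i) ↔ i = j) := by
  refine and_congr_right fun _ => ⟨fun h t => h _ t.castSucc_lt_last.ne, fun h t ht => ?_⟩
  obtain ⟨t, rfl⟩ := Fin.exists_castSucc_eq.2 ht
  exact h t

/-- The requirements on the outcome of the permutation protocol on the cake `R`. -/
structure IsPermutationOutcome (V : Profile) (c : Agent) (R : Set Cake) (o : Outcome) : Prop where
  allocation : IsPartialAllocation R o.share
  envyFree : IsEnvyFree V o.share
  dominates : ∃ i j : Agent, i ≠ c ∧ j ≠ c ∧ i ≠ j ∧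
    Dominates V R o.share c i ∧ Dominates V R o.share c j
  reallocated : ∀ j, o.SameAgent V c j → o.Reallocated V c j
  assign : (¬ ∃ j, o.SameAgent V c j) → ∀ t, o.holder t = (o.run t).assign

theorem IsRunSequence.isPermutationOutcome_of_isReassignment (h : IsRunSequence V c C o)
    (hlast : o.holder (Fin.last 4) = (o.run (Fin.last 4)).assign) {j : Agent} {s : Fin 4}
    {σ : Agent ≃ Fin 4}
    (hr : IsReassignment c (fun t => o.run t.castSucc)
      (trimmedValue (V c) fun t => o.run t.castSucc) (partValue V fun t => o.run t.castSucc) j s σ)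
    (hH : (fun t : Fin 4 => o.holder t.castSucc) =
      Function.update (fun t => (o.run t.castSucc).assign) s σ) :
    IsPermutationOutcome V c (C 0) o := by
  have hHt : ∀ t : Fin 4, o.holder t.castSucc =
      Function.update (fun t => (o.run t.castSucc).assign) s σ t := congrFun hH
  have hHs : o.holder s.castSucc = σ := by rw [hHt, Function.update_self]
  have hHne : ∀ t, t ≠ s.castSucc → o.holder t = (o.run t).assign := by
    intro t ht
    induction t using Fin.lastCases with
    | last => exact hlast
    | cast t => rw [hHt, Function.update_of_ne (fun hts => ht (congrArg Fin.castSucc hts))]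
  have hc : ∀ t, (o.run t).Complete (o.holder t c) := by
    intro t
    by_cases ht : t = s.castSucc
    · subst ht; rw [hHs]; exact hr.complete
    · rw [hHne t ht]; exact (h.core t).complete_cutter
  obtain ⟨i, hic, hij, hsig⟩ := hr.significant
  have hsig' : (o.run s.castSucc).Significant (V c) (o.holder s.castSucc i) := by
    rw [hHs]; exact hsig
  obtain ⟨t, hts, -, -⟩ := exists_fourth s s s
  have hsigj : (o.run t.castSucc).Significant (V c) (o.holder t.castSucc j) := by
    rw [hHne _ fun h => hts (Fin.castSucc_injective _ h)]
    exact (hr.same t j hr.ne).2 rfl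
  have hsame : o.SameAgent V c j := sameAgent_iff.2 ⟨hr.ne, hr.same⟩
  refine ⟨h.isPartialAllocation, fun k l => ?_,
    ⟨i, j, hic, hr.ne, hij, h.dominates hc hsig', h.dominates hc hsigj⟩, fun j' hj' => ?_,
    fun hno => absurd ⟨j, hsame⟩ hno⟩
  · have hsplit : ∀ i, (V k).val (o.share i) =
        ∑ t : Fin 4, (V k).val ((o.run t.castSucc).part (o.holder t.castSucc i)) +
          (V k).val ((o.run (Fin.last 4)).part ((o.run (Fin.last 4)).assign i)) := fun i => by
      rw [h.val_share, Fin.sum_univ_castSucc, hlast]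
    rw [hsplit, hsplit]
    refine add_le_add ?_ ((h.core _).envyFree k l)
    simp only [hHt]
    exact hr.envyFree k l
  · rw [sameAgent_iff] at hj'
    obtain rfl : j' = j := (hr.same 0 j' hj'.1).1 ((hj'.2 0 j' hj'.1).2 rfl)
    exact ⟨s.castSucc, s.castSucc_lt_last.ne, hHne, hc _, i, hic, hij, hsig'⟩

theorem IsRunSequence.isPermutationOutcome_of_not_sameAgent (h : IsRunSequence V c C o)
    (hH : ∀ t, o.holder t = (o.run t).assign) (hno : ¬ ∃ j, o.SameAgent V c j) :
    IsPermutationOutcome V c (C 0) o := by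
  have hc : ∀ t, (o.run t).Complete (o.holder t c) := fun t => by
    rw [hH]; exact (h.core t).complete_cutter
  have hdom : ∀ (t : Fin 4) (i : Agent),
      (o.run t.castSucc).Significant (V c) ((o.run t.castSucc).assign i) →
      Dominates V (C 0) o.share c i := fun t i hi => h.dominates hc (by rwa [hH])
  obtain ⟨i, hic, hi⟩ := (h.core (Fin.castSucc (0 : Fin 4))).exists_significant
  refine ⟨h.isPartialAllocation, fun k l => ?_, ?_, fun j hj => absurd ⟨j, hj⟩ hno, fun _ => hH⟩
  · rw [h.val_share, h.val_share]
    exact Finset.sum_le_sum fun t _ => hH t ▸ (h.core t).envyFree k l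
  · by_contra! hcon
    refine hno ⟨i, sameAgent_iff.2 ⟨hic, fun t k hkc => ⟨fun hk => ?_, ?_⟩⟩⟩
    · by_contra hki
      exact hcon i k hic hkc (Ne.symm hki) (hdom _ _ hi) (hdom _ _ hk)
    · rintro rfl
      obtain ⟨k', hkc', hk'⟩ := (h.core t.castSucc).exists_significant
      by_cases hkk : k = k'
      · exact hkk ▸ hk'
      · exact absurd (hdom _ _ hk') (hcon k k' hic hkc' hkk (hdom _ _ hi))

/-- The number of queries that suffices for the permutation protocol on a cake of `m` intervals. -/
def permutationBound (m : ℕ) : ℕ :=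
  coreBound m + (coreBound (4 * m) + (coreBound (4 * (4 * m)) + (coreBound (4 * (4 * (4 * m))) +
    (reallocBound (4 * (4 * (4 * m))) + (coreBound (4 * (4 * (4 * (4 * m)))) + 0)))))

theorem ensures_permutationProtocol {m : ℕ} {R : Set Cake} (hR : IsPieceOf m R) (c : Agent) :
    Ensures V (permutationBound m) (IsPermutationOutcome V c R)
      (permutationProtocol coreProtocol reallocate c R) := by
  refine (ensures_coreProtocol hR c).bind fun o₀ h₀ => ?_
  refine (ensures_coreProtocol h₀.isPieceOf_residue c).bind fun o₁ h₁ => ?_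
  refine (ensures_coreProtocol h₁.isPieceOf_residue c).bind fun o₂ h₂ => ?_
  refine (ensures_coreProtocol h₂.isPieceOf_residue c).bind fun o₃ h₃ => ?_
  have hruns : ∀ t : Fin 4, IsSwappableOutcome V c
      (![m, 4 * m, 4 * (4 * m), 4 * (4 * (4 * m))] t)
      (![R, o₀.residue, o₁.residue, o₂.residue] t) (![o₀, o₁, o₂, o₃] t) := by
    intro t
    fin_cases t
    exacts [h₀, h₁, h₂, h₃]
  refine (ensures_reallocate (m := 4 * (4 * (4 * m))) hruns fun t => ?_).bind fun H hH => ?_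
  · fin_cases t <;> simp <;> omega
  refine (ensures_coreProtocol h₃.isPieceOf_residue c).bind fun o₄ h₄ => .ret ?_
  set o : Outcome := { run := ![o₀, o₁, o₂, o₃, o₄], holder := ![H 0, H 1, H 2, H 3, o₄.assign] }
  have hseq : IsRunSequence V c ![R, o₀.residue, o₁.residue, o₂.residue, o₃.residue] o := by
    refine ⟨fun t => ?_, fun t => ?_⟩
    · fin_cases t
      exacts [h₀.toIsCoreOutcome, h₁.toIsCoreOutcome, h₂.toIsCoreOutcome, h₃.toIsCoreOutcome,
        h₄.toIsCoreOutcome]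
    · fin_cases t <;> rfl
  have hrun : ![o₀, o₁, o₂, o₃] = fun t : Fin 4 => o.run t.castSucc := by
    funext t
    fin_cases t <;> rfl
  have hholder : H = fun t : Fin 4 => o.holder t.castSucc := by
    funext t
    fin_cases t <;> rfl
  rw [hrun, hholder] at hH
  rcases hH with ⟨j, s, σ, hr, hH⟩ | ⟨hno, hH⟩
  · exact hseq.isPermutationOutcome_of_isReassignment rfl hr hH
  · refine hseq.isPermutationOutcome_of_not_sameAgent (fun t => ?_) fun ⟨j, hj⟩ =>
      hno ⟨j, sameAgent_iff.1 hj⟩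
    induction t using Fin.lastCases with
    | last => rfl
    | cast t => exact congrFun hH t

end permutation

end FiveRuns

end CakeCutting

open CakeCutting
theorem mainTheorem2 :
    ∃ (core : Agent → Set Cake → Protocol CoreOutcome)
      (realloc : Agent → (Fin 4 → CoreOutcome) → Protocol (Fin 4 → Agent ≃ Fin 4))
      (K : ℕ → ℕ),
      ∀ (m : ℕ) (R : Set Cake), IsPieceOf m R → ∀ (c : Agent) (V : Profile),
        (∀ (n : ℕ) (o : CoreOutcome), (core c R).Run V n o →
          n ≤ K m ∧ IsCoreOutcome V c R o) ∧
        (∀ (n : ℕ) (o : Outcome), (permutationProtocol core realloc c R).Run V n o →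
          n ≤ K m ∧
          IsPartialAllocation R o.share ∧
          IsEnvyFree V o.share ∧
          (∃ i j : Agent, i ≠ c ∧ j ≠ c ∧ i ≠ j ∧
            Dominates V R o.share c i ∧ Dominates V R o.share c j) ∧
          (∀ j : Agent, o.SameAgent V c j → o.Reallocated V c j) ∧
          ((¬ ∃ j : Agent, o.SameAgent V c j) →
            ∀ t, o.holder t = (o.run t).assign)) := by
  refine ⟨coreProtocol, reallocate, permutationBound, fun m R hR c V =>
    ⟨fun n o hrun => ?_, fun n o hrun => ?_⟩⟩
  · obtain ⟨hn, ho⟩ := ensures_coreProtocol hR c n o hrun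
    exact ⟨hn.trans (Nat.le_add_right _ _), ho.toIsCoreOutcome⟩
  · obtain ⟨hn, ho⟩ := ensures_permutationProtocol hR c n o hrun
    exact ⟨hn, ho.allocation, ho.envyFree, ho.dominates, ho.reallocated, ho.assign⟩
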